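/- Let $\gamma_1>\gamma_2>1$ and $0<s<1/2$ be fixed. For an integer $k\ge 2$ such that $p=\gamma_1\frac{\log k}{k}$ and $q=\gamma_2\frac{\log k}{k}$ lie in $[0,1]$ (which holds for all large $k$), let $A=(a_{ij})$ be the random signed adjacency matrix drawn from the signed stochastic bisection model $\mathsf{SignedBlock}_k(p,q,s)$. That is, the nodes are $\{1,\dots,2k\}$, split into the communities $\{1,\dots,k\}$ and $\{k+1,\dots,2k\}$; every pair $i<j$ is joined by an edge with probability $p$ if $i,j$ are in the same community and with probability $q$ otherwise, and carries a negative sign with probability $s$ if $i,j$ are in the same community and with probability $1-s$ otherwise, all these choices being mutually independent; $A$ is symmetric with zero diagonal, and $a_{ij}$ is $0$ if $\{i,j\}$ is not an edge, $-1$ if it is an edge with negative sign, and $+1$ if it is an edge with positive sign. Let $D$ be the diagonal matrix of the degrees $d_i=\sum_j|a_{ij}|$, and let $\mathcal{L}=D^{-1/2}(D-A)D^{-1/2}$ be the normalized signed Laplacian, where $(D^{-1/2})_{ii}=0$ if $d_i=0$. Let $\lambda_1(\mathcal{L})$ be the least eigenvalue of $\mathcal{L}$, and let $\overline{u_1}=\frac{1}{\sqrt{2k}}(1,\dots,1,-1,\dots,-1)^T\in\mathbb{R}^{2k}$,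 with $k$ entries of each sign. Then there exist constants $C_1,C_2>0$, not depending on $k$, such that for all sufficiently large $k$, with probability at least $1-k^{-C_1}$, the following hold simultaneously: the eigenvalue $\lambda_1(\mathcal{L})$ is simple; its unit eigenvector $u_1$ is uniquely determined up to sign; and for every unit eigenvector $u_1$ of $\mathcal{L}$ corresponding to $\lambda_1(\mathcal{L})$ there is a sign $\tau\in\{\pm1\}$ such that $$\|\tau u_1-\overline{u_1}\|_2\le C_2(\log k)^{-1/2}.$$ -/

import Mathlib

open MeasureTheory ProbabilityTheory
open scoped unitInterval

noncomputable section

/-- Real matrices carry the product sigma-algebra of their entries. -/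
instance Matrix.instMeasurableSpaceReal {m n : Type*} : MeasurableSpace (Matrix m n ℝ) :=
  inferInstanceAs (MeasurableSpace (m → n → ℝ))

namespace SignedSBM

/-! ### Signed inhomogeneous Erdős–Rényi graphs -/

/-- The unordered pairs `{i, j}` of distinct nodes, listed with `i < j`. -/
abbrev NodePair (n : ℕ) : Type := {e : Fin n × Fin n // e.1 < e.2}

/-- The signed adjacency entry of a pair: the first bit says whether the pair is an edge, the
second whether the sign is negative. If both bits are read as numbers `P, S ∈ {0, 1}`, this is
`P * (1 - 2 * S)`. -/
def signedEntry (b : Bool × Bool) : ℝ :=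
  (if b.1 then 1 else 0) * (1 - 2 * (if b.2 then 1 else 0))

/-- The signed adjacency matrix (symmetric, zero diagonal) of a choice of edge bit and sign bit
for every pair of nodes. -/
def signedAdjacency {n : ℕ} (ω : NodePair n → Bool × Bool) : Matrix (Fin n) (Fin n) ℝ :=
  Matrix.of fun i j =>
    if h : i < j then signedEntry (ω ⟨(i, j), h⟩)
    else if h : j < i then signedEntry (ω ⟨(j, i), h⟩)
    else 0

/-- The law of the random signed adjacency matrix `A` on `n` nodes: for each pair `i < j`, an edge
is added with probability `P i j` and its sign is negative with probability `S i j`, all these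
choices being mutually independent. The matrices `P` and `S` are meant to be symmetric with zero
diagonal. -/
def signedErdosRenyi {n : ℕ} (P S : Matrix (Fin n) (Fin n) I) :
    Measure (Matrix (Fin n) (Fin n) ℝ) :=
  (Measure.pi fun e : NodePair n =>
    (bernoulliMeasure true false (P e.1.1 e.1.2)).prod
      (bernoulliMeasure true false (S e.1.1 e.1.2))).map signedAdjacency

/-- The `n × n` extension, with zero diagonal, of an `m × m` matrix of probabilities between the
classes of the partition of the nodes given by the labelling `c`. -/
def blockExtend {n m : ℕ} (c : Fin n → Fin m) (M : Matrix (Fin m) (Fin m) I) :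
    Matrix (Fin n) (Fin n) I :=
  Matrix.of fun i j => if i = j then 0 else M (c i) (c j)

/-- The even bipartition of the `2k` nodes: the first `k` nodes and the last `k` nodes. -/
def community (k : ℕ) (i : Fin (2 * k)) : Fin 2 := if (i : ℕ) < k then 0 else 1

/-- The signed stochastic bisection model `SignedBlock_k(p, q, s)`, as a law on signed adjacency
matrices (`σ s` is `1 - s`). -/
def signedBlock (k : ℕ) (p q s : I) : Measure (Matrix (Fin (2 * k)) (Fin (2 * k)) ℝ) :=
  signedErdosRenyi
    (blockExtend (community k) !![p, q; q, p])
    (blockExtend (community k) !![s, σ s; σ s, s])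

/-! ### Laplacians -/

/-- The degree of node `i`: the number of edges at `i`, i.e. the `i`-th row sum of `|A|`. -/
def degree {n : ℕ} (A : Matrix (Fin n) (Fin n) ℝ) (i : Fin n) : ℝ := ∑ j, |A i j|

/-- The signed Laplacian `L = D - A`. -/
def signedLaplacian {n : ℕ} (A : Matrix (Fin n) (Fin n) ℝ) : Matrix (Fin n) (Fin n) ℝ :=
  Matrix.diagonal (degree A) - A

/-- The matrix `D^{-1/2}`, with the convention that the entry of a node of degree `0` is `0`
(here because `0⁻¹ = 0`). -/
def invSqrtDegree {n : ℕ} (A : Matrix (Fin n) (Fin n) ℝ) : Matrix (Fin n) (Fin n) ℝ :=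
  Matrix.diagonal fun i => (√(degree A i))⁻¹

/-- The normalized signed Laplacian `D^{-1/2} L D^{-1/2}`. -/
def normalizedLaplacian {n : ℕ} (A : Matrix (Fin n) (Fin n) ℝ) : Matrix (Fin n) (Fin n) ℝ :=
  invSqrtDegree A * signedLaplacian A * invSqrtDegree A

/-! ### The least eigenvalue and its eigenvectors -/

/-- `λ₁(X)`, the least eigenvalue of a symmetric matrix `X`. -/
def leastEigenvalue {n : ℕ} (X : Matrix (Fin n) (Fin n) ℝ) : ℝ :=
  sInf {t : ℝ | Module.End.HasEigenvalue (Matrix.toEuclideanLin X) t}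

/-- `t` is a simple eigenvalue of the symmetric matrix `X`: its eigenspace is a line. -/
def IsSimpleEigenvalue {n : ℕ} (X : Matrix (Fin n) (Fin n) ℝ) (t : ℝ) : Prop :=
  Module.finrank ℝ (Module.End.eigenspace (Matrix.toEuclideanLin X) t) = 1

/-- `u` is an eigenvector of `X` of Euclidean norm one for the eigenvalue `t`. -/
def IsUnitEigenvector {n : ℕ} (X : Matrix (Fin n) (Fin n) ℝ) (t : ℝ)
    (u : EuclideanSpace ℝ (Fin n)) : Prop :=
  Module.End.HasEigenvector (Matrix.toEuclideanLin X) t u ∧ ‖u‖ = 1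

/-- The vector `(2k)^{-1/2} (1, …, 1, -1, …, -1)`, with `k` entries of each sign. -/
def meanEigenvector (k : ℕ) : EuclideanSpace ℝ (Fin (2 * k)) :=
  WithLp.toLp 2 fun i => (if (i : ℕ) < k then 1 else -1) / √(2 * (k : ℝ))

end SignedSBM

end

/-! When no degree vanishes, `1 - L = D^{-1/2} A D^{-1/2}` for the normalized Laplacian `L`. Put `θ
= 1 - 2s`, `δ = (p+q)k`, `ρ = (γ₁-γ₂)/(γ₁+γ₂)`; let `u` be the community vector and `o` the
normalized all-ones vector. The mean of `A` is `θδ(uuᵀ + ρooᵀ) - θp·1`, and each mean degree is `δ -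
p`. Hence `1 - L` should be near `θ(uuᵀ + ρooᵀ)`, whose spectral gap `θ(1-ρ)` is independent of `k`.
As `δ` has order `log k` and the noise `A - EA` has norm `O(√(log k))`, the normalized error is
`O((log k)^{-1/2})`. `isNearSpike_of_regular` makes this precise, and `spectral_of_isNearSpike`
turns it into simplicity and closeness of the eigenvector.

In this regime the degrees need not be uniformly close to `δ`. Two weaker facts suffice: every
degree exceeds `log k / 10` (`measure_degree_le_exp`, a Chernoff bound), and degrees concentrate in
mean square (`sum_sq_degree_sub_le`, from the norm bound for `|A| - E|A|` applied to the all-ones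
vector). The coordinates of `u` and `o` have constant modulus, so mean-square control is all that
pairing them with `D^{-1/2}x` needs (`abs_inner_scaleVec_sub_le`).

The noise bound `exists_norm_symMatrix_bound` is a trace method with power `N` of order `log k`.
Walks are not enumerated: the sparse `n × n` matrix is compared with a dense `r × r` one, `r ≈ np +
N` (`integral_trace_pow_le`). A coincidence pattern with `t` vertices occurs at most `n^t` times on
`n` nodes, with expectation at most `p^(t-1)`; on `r` nodes it occurs at least `(np)^t` times, with
expectation at least `1`. The dense matrix is handled by a net of `exp(O(r))` points; `r` and `N`
are comparable, so this costs only a constant factor in the norm. -/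

noncomputable section

namespace SignedSBM

/-! ### Symmetric matrices indexed by pairs of nodes -/

/-- The symmetric matrix with zero diagonal and prescribed entries above the diagonal. -/
def symMatrix {n : ℕ} (x : NodePair n → ℝ) : Matrix (Fin n) (Fin n) ℝ :=
  Matrix.of fun i j =>
    if h : i < j then x ⟨(i, j), h⟩
    else if h : j < i then x ⟨(j, i), h⟩
    else 0

/-- The unordered pair of two distinct nodes. -/
def pairOf {n : ℕ} (i j : Fin n) (h : i ≠ j) : NodePair n :=
  if h' : i < j then ⟨(i, j), h'⟩ else ⟨(j, i), lt_of_le_of_ne (not_lt.1 h') h.symm⟩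

lemma symMatrix_of_ne {n : ℕ} (x : NodePair n → ℝ) {i j : Fin n} (h : i ≠ j) :
    symMatrix x i j = x (pairOf i j h) := by
  rcases lt_or_gt_of_ne h with h' | h'
  · simp [symMatrix, pairOf, h']
  · simp [symMatrix, pairOf, h', not_lt_of_gt h']

@[simp] lemma symMatrix_self {n : ℕ} (x : NodePair n → ℝ) (i : Fin n) :
    symMatrix x i i = 0 := by simp [symMatrix]

lemma symMatrix_comm {n : ℕ} (x : NodePair n → ℝ) (i j : Fin n) :
    symMatrix x i j = symMatrix x j i := by
  rcases lt_trichotomy i j with h | h | h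
  · simp [symMatrix, h, not_lt_of_gt h]
  · simp [h]
  · simp [symMatrix, h, not_lt_of_gt h]

lemma pairOf_eq_iff {n : ℕ} {i j i' j' : Fin n} (h : i ≠ j) (h' : i' ≠ j') :
    pairOf i j h = pairOf i' j' h' ↔ (i = i' ∧ j = j') ∨ (i = j' ∧ j = i') := by
  unfold pairOf
  split_ifs with h1 h2 h2 <;> simp only [Subtype.mk.injEq, Prod.mk.injEq] <;> grind

lemma signedAdjacency_eq {n : ℕ} (ω : NodePair n → Bool × Bool) :
    signedAdjacency ω = symMatrix fun e => signedEntry (ω e) := rfl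

/-! ### Expectations of products of independent variables -/

/-- Factors reading the same coordinate are collected first; independence then splits the integral.
-/
lemma integral_prod_comp {ι κ α : Type*} [Fintype ι] [Fintype κ] [DecidableEq κ]
    [MeasurableSpace α] (μ : κ → Measure α) [∀ c, IsProbabilityMeasure (μ c)]
    (F : ι → α → ℝ) (e : ι → κ) :
    ∫ ω, ∏ i, F i (ω (e i)) ∂Measure.pi μ =
      ∏ c, ∫ x, ∏ i with e i = c, F i x ∂μ c := by
  rw [← integral_fintype_prod_eq_prod (𝕜 := ℝ)]
  congr 1
  ext ω
  rw [← Finset.prod_fiberwise (s := Finset.univ) (g := e)]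
  refine Finset.prod_congr rfl fun c _ => Finset.prod_congr rfl fun i hi => ?_
  rw [(Finset.mem_filter.1 hi).2]

/-! ### Matrix powers as sums over walks -/

/-- The arbitrary weight `g` on the endpoints makes the induction close: removing the first vertex
only changes `g`. -/
lemma sum_walk_eq {V : Type*} [Fintype V] [DecidableEq V] (W : Matrix V V ℝ) (N : ℕ)
    (g : V → V → ℝ) :
    ∑ w : Fin (N + 1) → V,
        g (w 0) (w (Fin.last N)) * ∏ i : Fin N, W (w i.castSucc) (w i.succ) =
      ∑ a, ∑ b, g a b * (W ^ N) a b := by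
  induction N generalizing g with
  | zero =>
    rw [← (Equiv.funUnique (Fin 1) V).symm.sum_comp]
    simp [Matrix.one_apply]
  | succ N ih =>
    rw [← (Fin.consEquiv fun _ => V).sum_comp, Fintype.sum_prod_type, Finset.sum_comm]
    have h := ih fun c b => ∑ a, g a b * W a c
    have e1 : ∀ w : Fin (N + 1) → V,
        ∑ a, g ((Fin.consEquiv fun _ => V) (a, w) 0)
            ((Fin.consEquiv fun _ => V) (a, w) (Fin.last (N + 1))) *
          ∏ i : Fin (N + 1), W ((Fin.consEquiv fun _ => V) (a, w) i.castSucc)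
            ((Fin.consEquiv fun _ => V) (a, w) i.succ) =
        (∑ a, g a (w (Fin.last N)) * W a (w 0)) *
          ∏ i : Fin N, W (w i.castSucc) (w i.succ) := by
      intro w
      rw [Finset.sum_mul]
      refine Finset.sum_congr rfl fun a _ => ?_
      rw [Fin.prod_univ_succ]
      simp only [Fin.consEquiv_apply, Fin.cons_zero, ← Fin.succ_last, Fin.cons_succ,
        Fin.castSucc_zero, ← Fin.succ_castSucc, mul_assoc]
    rw [Finset.sum_congr rfl fun w _ => e1 w, h]
    simp only [pow_succ', Matrix.mul_apply, Finset.mul_sum, Finset.sum_mul]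
    rw [Finset.sum_comm]
    conv_rhs => rw [Finset.sum_comm]
    refine Finset.sum_congr rfl fun b _ => ?_
    rw [Finset.sum_comm]
    simp only [mul_assoc]

lemma trace_pow_eq_sum_walk {V : Type*} [Fintype V] [DecidableEq V] (W : Matrix V V ℝ) (N : ℕ) :
    (W ^ N).trace = ∑ w : Fin (N + 1) → V,
      (if w 0 = w (Fin.last N) then 1 else 0) * ∏ i : Fin N, W (w i.castSucc) (w i.succ) := by
  rw [sum_walk_eq W N fun a b => if a = b then 1 else 0]
  simp [Matrix.trace]

/-! ### Closed walks that use every edge at least twice -/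

/-- A closed walk without loops that uses every edge at least twice. -/
def IsGoodWalk {V : Type*} {N : ℕ} (w : Fin (N + 1) → V) : Prop :=
  w 0 = w (Fin.last N) ∧ ∀ i : Fin N, w i.castSucc ≠ w i.succ ∧ ∃ j, j ≠ i ∧
    (w j.castSucc = w i.castSucc ∧ w j.succ = w i.succ ∨
      w j.castSucc = w i.succ ∧ w j.succ = w i.castSucc)

/-- Two maps identify the same arguments. -/
def SameKer {ι V V' : Type*} (w : ι → V) (w' : ι → V') : Prop :=
  ∀ i j, w i = w j ↔ w' i = w' j

/-- `IsGoodWalk` involves only equalities between values of the walk, so it can be transported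
between vertex sets of different sizes. -/
lemma SameKer.isGoodWalk_iff {V V' : Type*} {N : ℕ} {w : Fin (N + 1) → V}
    {w' : Fin (N + 1) → V'} (h : SameKer w w') : IsGoodWalk w ↔ IsGoodWalk w' := by
  simp only [IsGoodWalk, ne_eq, h _ _]

lemma SameKer.symm {ι V V' : Type*} {w : ι → V} {w' : ι → V'} (h : SameKer w w') :
    SameKer w' w := fun i j => (h i j).symm

/-- The maps with the same kernel as `w'` are the embeddings of the range of `w'`. -/
def sameKerEquiv {ι V V' : Type*} (w' : ι → V') :
    {w : ι → V // SameKer w w'} ≃ (Set.range w' ↪ V) where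
  toFun w := ⟨fun y => w.1 y.2.choose, fun y z h => by
    have h' := (w.2 _ _).1 h
    rw [y.2.choose_spec, z.2.choose_spec] at h'
    exact Subtype.ext h'⟩
  invFun f := ⟨fun i => f ⟨w' i, Set.mem_range_self i⟩, fun _ _ =>
    f.injective.eq_iff.trans Subtype.ext_iff⟩
  left_inv w := by
    ext i
    exact (w.2 _ _).2 (Exists.choose_spec (⟨i, rfl⟩ : w' i ∈ Set.range w'))
  right_inv f := by
    ext y
    exact congrArg f (Subtype.ext y.2.choose_spec)

lemma card_sameKer {ι V V' : Type*} [Fintype ι] [Fintype V] [DecidableEq V'] (w' : ι → V')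
    [Fintype (ι → V)] [DecidablePred fun w : ι → V => SameKer w w'] :
    (Finset.univ.filter fun w : ι → V => SameKer w w').card =
      (Fintype.card V).descFactorial (Finset.univ.image w').card := by
  classical
  rw [← Fintype.card_subtype, Fintype.card_congr (sameKerEquiv w'), Fintype.card_embedding_eq,
    ← Set.toFinset_card, Set.toFinset_range]

lemma SameKer.card_image {ι V V' : Type*} [Fintype ι] [DecidableEq V] [DecidableEq V'] {w : ι → V} {w' : ι → V'}
    (h : SameKer w w') : (Finset.univ.image w).card = (Finset.univ.image w').card := by
  have e : Set.range w ≃ Set.range w' :=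
    { toFun := fun y => ⟨w' y.2.choose, _, rfl⟩
      invFun := fun y => ⟨w y.2.choose, _, rfl⟩
      left_inv := fun y => Subtype.ext (by
        have h1 := Exists.choose_spec (⟨_, rfl⟩ : w' y.2.choose ∈ Set.range w')
        rw [← h] at h1
        exact h1.trans y.2.choose_spec)
      right_inv := fun y => Subtype.ext (by
        have h1 := Exists.choose_spec (⟨_, rfl⟩ : w y.2.choose ∈ Set.range w)
        rw [h] at h1
        exact h1.trans y.2.choose_spec) }
  have := Fintype.card_congr e
  rwa [← Set.toFinset_card, Set.toFinset_range, ← Set.toFinset_card, Set.toFinset_range] at this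

open Classical in
/-- The weighted number of good walks on `n` nodes is at most the number of good walks on `r`
nodes, if `r` is large compared with the expected degree and the length. -/
lemma sum_goodWalk_le (n r N : ℕ) (p : ℝ) (hp : 0 ≤ p) (hr : n * p + N + 1 ≤ r) :
    ∑ w : Fin (N + 1) → Fin n,
        (if IsGoodWalk w then p ^ (Finset.univ.image w).card else 0) ≤
      ∑ w : Fin (N + 1) → Fin r, (if IsGoodWalk w then 1 else 0 : ℝ) := by
  have hN : N + 1 ≤ r := by
    have : (N + 1 : ℝ) ≤ r := by nlinarith [mul_nonneg (Nat.cast_nonneg (α := ℝ) n) hp]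
    exact_mod_cast this
  have hpos : ∀ t, t ≤ N + 1 → (0 : ℝ) < r.descFactorial t := fun t ht => by
    exact_mod_cast Nat.descFactorial_pos.2 (ht.trans hN)
  have hcard : ∀ (m : ℕ) (w : Fin (N + 1) → Fin m), (Finset.univ.image w).card ≤ N + 1 :=
    fun m w => Finset.card_image_le.trans (by simp)
  -- Double counting: the weight of each walk on `n` nodes is spread evenly over the walks on `r`
  -- nodes with the same kernel. There is at least one of these, since `r ≥ N + 1`.
  calc _ = ∑ w : Fin (N + 1) → Fin n, ∑ w' : Fin (N + 1) → Fin r,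
        (if SameKer w' w then (if IsGoodWalk w' then
          p ^ (Finset.univ.image w').card /
            (r.descFactorial (Finset.univ.image w').card : ℝ) else 0) else 0) := by
        refine Finset.sum_congr rfl fun w _ => ?_
        have h1 : ∀ w' : Fin (N + 1) → Fin r, (if SameKer w' w then (if IsGoodWalk w' then
            p ^ (Finset.univ.image w').card /
              (r.descFactorial (Finset.univ.image w').card : ℝ) else 0) else 0) =
            (if SameKer w' w then (if IsGoodWalk w then
            p ^ (Finset.univ.image w).card /
              (r.descFactorial (Finset.univ.image w).card : ℝ) else 0) else 0) := by
          intro w'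
          by_cases h : SameKer w' w
          · simp only [h, if_true, h.isGoodWalk_iff, h.card_image]
          · simp [h]
        rw [Finset.sum_congr rfl fun w' _ => h1 w', ← Finset.sum_filter, Finset.sum_const,
          card_sameKer, Fintype.card_fin, nsmul_eq_mul]
        have := (hpos _ (hcard n w)).ne'
        split_ifs
        · field_simp
        · simp
    _ = ∑ w' : Fin (N + 1) → Fin r, ∑ w : Fin (N + 1) → Fin n,
        (if SameKer w w' then (if IsGoodWalk w' then
          p ^ (Finset.univ.image w').card /
            (r.descFactorial (Finset.univ.image w').card : ℝ) else 0) else 0) := by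
        rw [Finset.sum_comm]
        refine Finset.sum_congr rfl fun w' _ => Finset.sum_congr rfl fun w _ => ?_
        rw [if_congr (⟨SameKer.symm, SameKer.symm⟩ : SameKer w' w ↔ SameKer w w') rfl rfl]
    _ ≤ _ := by
        refine Finset.sum_le_sum fun w' _ => ?_
        rw [← Finset.sum_filter, Finset.sum_const, card_sameKer, Fintype.card_fin, nsmul_eq_mul]
        split_ifs
        · set t := (Finset.univ.image w').card
          have ht : t ≤ N + 1 := hcard r w'
          -- Each walk on `r` nodes receives at most one unit, because `n^t p^t ≤ (r + 1 - t)^t ≤ r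
          -- (r - 1) ⋯ (r - t + 1)`.
          rw [← mul_div_assoc, div_le_one (hpos t ht)]
          have h1 : (n.descFactorial t : ℝ) ≤ (n : ℝ) ^ t := by
            exact_mod_cast Nat.descFactorial_le_pow n t
          have h2 : ((r + 1 - t : ℕ) : ℝ) ^ t ≤ r.descFactorial t := by
            exact_mod_cast Nat.pow_sub_le_descFactorial r t
          have h3 : n * p ≤ ((r + 1 - t : ℕ) : ℝ) := by
            rw [Nat.cast_sub (by omega)]
            have : (t : ℝ) ≤ N + 1 := by exact_mod_cast ht
            push_cast; linarith
          calc (n.descFactorial t : ℝ) * p ^ t ≤ (n : ℝ) ^ t * p ^ t := by gcongr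
            _ = (n * p) ^ t := by rw [mul_pow]
            _ ≤ ((r + 1 - t : ℕ) : ℝ) ^ t := by gcongr
            _ ≤ _ := h2
        · simp

/-- A connected graph has at most one vertex more than it has edges. -/
lemma card_image_walk_le {V E : Type*} [DecidableEq V] [DecidableEq E] (N : ℕ)
    (w : Fin (N + 1) → V) (e : Fin N → E)
    (h : ∀ i j, e i = e j → w i.succ = w j.castSucc ∨ w i.succ = w j.succ) :
    (Finset.univ.image w).card ≤ (Finset.univ.image e).card + 1 := by
  induction N with
  | zero => simp
  | succ N ih =>
    have h1 := ih (fun i => w i.castSucc) (fun i => e i.castSucc) fun i j hij => by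
      simpa using h _ _ hij
    have hw : Finset.univ.image w =
        insert (w (Fin.last (N + 1))) (Finset.univ.image fun i : Fin (N + 1) => w i.castSucc) := by
      ext v
      simp only [Finset.mem_image, Finset.mem_univ, true_and, Finset.mem_insert,
        Fin.exists_fin_succ', or_comm, eq_comm]
    have he : Finset.univ.image e =
        insert (e (Fin.last N)) (Finset.univ.image fun i : Fin N => e i.castSucc) := by
      ext v
      simp only [Finset.mem_image, Finset.mem_univ, true_and, Finset.mem_insert,
        Fin.exists_fin_succ', or_comm, eq_comm]
    by_cases hm : w (Fin.last (N + 1)) ∈ Finset.univ.image fun i : Fin (N + 1) => w i.castSucc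
    · rw [hw, Finset.insert_eq_of_mem hm, he]
      exact h1.trans (by gcongr; exact Finset.subset_insert _ _)
    -- A vertex seen for the first time is reached through an edge seen for the first time, as `h`
    -- would otherwise place it among the earlier vertices.
    · have hn : e (Fin.last N) ∉ Finset.univ.image fun i : Fin N => e i.castSucc := by
        intro hh
        obtain ⟨j, -, hj⟩ := Finset.mem_image.1 hh
        apply hm
        have := h _ _ hj.symm
        rw [Fin.succ_last] at this
        rcases this with h2 | h2
        · exact Finset.mem_image.2 ⟨_, Finset.mem_univ _, h2.symm⟩
        · refine Finset.mem_image.2 ⟨j.succ, Finset.mem_univ _, ?_⟩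
          rw [h2, Fin.succ_castSucc]
      rw [hw, he, Finset.card_insert_of_notMem hm, Finset.card_insert_of_notMem hn]
      omega

/-! ### Comparison of expected traces -/

section Walk

variable {n N : ℕ}

/-- The pair of nodes traversed in the `i`-th step of a loopless walk. -/
def walkEdge (w : Fin (N + 1) → Fin n) (hw : ∀ i : Fin N, w i.castSucc ≠ w i.succ)
    (i : Fin N) : NodePair n :=
  pairOf _ _ (hw i)

lemma isGoodWalk_iff (w : Fin (N + 1) → Fin n) (hw : ∀ i : Fin N, w i.castSucc ≠ w i.succ) :
    IsGoodWalk w ↔ w 0 = w (Fin.last N) ∧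
      ∀ i, 2 ≤ (Finset.univ.filter fun j => walkEdge w hw j = walkEdge w hw i).card := by
  refine and_congr_right fun _ => forall_congr' fun i => ?_
  have : 2 ≤ (Finset.univ.filter fun j => walkEdge w hw j = walkEdge w hw i).card ↔
      ∃ j, j ≠ i ∧ walkEdge w hw j = walkEdge w hw i := by
    constructor
    · intro h
      obtain ⟨j, hj, hji⟩ := Finset.exists_mem_ne (Nat.lt_of_succ_le h) i
      exact ⟨j, hji, (Finset.mem_filter.1 hj).2⟩
    · rintro ⟨j, hji, hj⟩
      exact Finset.one_lt_card.2 ⟨j, by simpa using hj, i, by simp, hji⟩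
  rw [this]
  simp only [walkEdge, pairOf_eq_iff, hw i, ne_eq, not_false_eq_true, true_and]

/-- By independence, only the multiplicity with which each pair is traversed matters. -/
lemma integral_walk_prod {α : Type*} [MeasurableSpace α] (μ : NodePair n → Measure α)
    [∀ e, IsProbabilityMeasure (μ e)] (f : NodePair n → α → ℝ)
    (w : Fin (N + 1) → Fin n) (hw : ∀ i : Fin N, w i.castSucc ≠ w i.succ) :
    ∫ ω, ∏ i : Fin N, symMatrix (fun e => f e (ω e)) (w i.castSucc) (w i.succ) ∂Measure.pi μ =
      ∏ e, ∫ x, f e x ^ (Finset.univ.filter fun i => walkEdge w hw i = e).card ∂μ e := by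
  have h := integral_prod_comp μ (fun i => f (walkEdge w hw i)) (walkEdge w hw)
  have e1 : ∀ ω : NodePair n → α,
      ∏ i : Fin N, symMatrix (fun e => f e (ω e)) (w i.castSucc) (w i.succ) =
      ∏ i, f (walkEdge w hw i) (ω (walkEdge w hw i)) := fun ω =>
    Finset.prod_congr rfl fun i _ => symMatrix_of_ne _ (hw i)
  simp only [e1, h]
  refine Finset.prod_congr rfl fun c _ => integral_congr_ae (.of_forall fun x => ?_)
  dsimp only
  rw [← Finset.prod_const]
  exact Finset.prod_congr rfl fun i hi => by rw [(Finset.mem_filter.1 hi).2]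

lemma integral_walk_prod_of_loop {α : Type*} [MeasurableSpace α] (μ : Measure (NodePair n → α))
    (f : NodePair n → α → ℝ) (w : Fin (N + 1) → Fin n)
    (hw : ¬ ∀ i : Fin N, w i.castSucc ≠ w i.succ) :
    ∫ ω, ∏ i : Fin N, symMatrix (fun e => f e (ω e)) (w i.castSucc) (w i.succ) ∂μ = 0 := by
  push Not at hw
  obtain ⟨i, hi⟩ := hw
  have : ∀ ω : NodePair n → α,
      ∏ i : Fin N, symMatrix (fun e => f e (ω e)) (w i.castSucc) (w i.succ) = 0 := fun ω =>
    Finset.prod_eq_zero (Finset.mem_univ i) (by rw [hi, symMatrix_self])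
  simp [this]

-- A pair traversed exactly once kills the expectation by centering. In a good walk each distinct
-- edge costs a factor at most `p`, and connectedness gives at least `t - 1` edges for `t` vertices;
-- the prefactor `p⁻¹` pays for the missing edge.
open Classical in
lemma integral_walk_le {α : Type*} [MeasurableSpace α] (μ : NodePair n → Measure α)
    [∀ e, IsProbabilityMeasure (μ e)] (f : NodePair n → α → ℝ) {p : ℝ} (hp0 : 0 < p)
    (hp1 : p ≤ 1) (hf1 : ∀ e, ∫ x, f e x ∂μ e = 0)
    (hf : ∀ e j, 2 ≤ j → |∫ x, f e x ^ j ∂μ e| ≤ p) (w : Fin (N + 1) → Fin n) :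
    (if w 0 = w (Fin.last N) then 1 else 0) *
      ∫ ω, ∏ i : Fin N, symMatrix (fun e => f e (ω e)) (w i.castSucc) (w i.succ) ∂Measure.pi μ ≤
      p⁻¹ * (if IsGoodWalk w then p ^ (Finset.univ.image w).card else 0) := by
  have hr : 0 ≤ p⁻¹ * (if IsGoodWalk w then p ^ (Finset.univ.image w).card else 0) := by
    positivity
  by_cases hc : w 0 = w (Fin.last N)
  swap
  · simpa [hc] using hr
  rw [if_pos hc, one_mul]
  by_cases hw : ∀ i : Fin N, w i.castSucc ≠ w i.succ
  swap
  · rwa [integral_walk_prod_of_loop _ _ _ hw]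
  rw [integral_walk_prod μ f w hw]
  by_cases hg : IsGoodWalk w
  · rw [if_pos hg]
    have hg' := ((isGoodWalk_iff w hw).1 hg).2
    have hcard := card_image_walk_le N w (walkEdge w hw) fun i j hij => by
      rw [walkEdge, walkEdge, pairOf_eq_iff] at hij
      tauto
    calc _ ≤ |∏ e, ∫ x, f e x ^
          (Finset.univ.filter fun i => walkEdge w hw i = e).card ∂μ e| := le_abs_self _
      _ = ∏ e, |∫ x, f e x ^
          (Finset.univ.filter fun i => walkEdge w hw i = e).card ∂μ e| := Finset.abs_prod _ _
      _ ≤ ∏ e, (if e ∈ Finset.univ.image (walkEdge w hw) then p else 1) := by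
          refine Finset.prod_le_prod (fun _ _ => abs_nonneg _) fun e _ => ?_
          split_ifs with he
          · obtain ⟨i, -, rfl⟩ := Finset.mem_image.1 he
            exact hf _ _ (hg' i)
          · rw [Finset.card_eq_zero.2]
            · simp
            · refine Finset.filter_eq_empty_iff.2 fun i _ hi => he ?_
              exact Finset.mem_image.2 ⟨i, Finset.mem_univ _, hi⟩
      _ = p ^ (Finset.univ.image (walkEdge w hw)).card := by
          rw [Finset.prod_ite_mem, Finset.univ_inter, Finset.prod_const]
      _ = p⁻¹ * p ^ ((Finset.univ.image (walkEdge w hw)).card + 1) := by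
          rw [pow_succ]; field_simp
      _ ≤ _ := by
          gcongr p⁻¹ * ?_
          exact pow_le_pow_of_le_one hp0.le hp1 (by convert hcard)
  · rw [if_neg hg, mul_zero]
    rw [isGoodWalk_iff w hw] at hg
    push Not at hg
    obtain ⟨i, hi⟩ := hg hc
    refine (Finset.prod_eq_zero (Finset.mem_univ (walkEdge w hw i)) ?_).le
    have : 0 < (Finset.univ.filter fun j => walkEdge w hw j = walkEdge w hw i).card :=
      Finset.card_pos.2 ⟨i, by simp⟩
    rw [show (Finset.univ.filter fun j => walkEdge w hw j = walkEdge w hw i).card = 1 by omega]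
    simpa using hf1 _

-- The reverse comparison: each edge used by a good walk contributes at least `1`, and every other
-- closed walk has expectation zero.
open Classical in
lemma le_integral_walk {α : Type*} [MeasurableSpace α] (μ : NodePair n → Measure α)
    [∀ e, IsProbabilityMeasure (μ e)] (f : NodePair n → α → ℝ)
    (hf1 : ∀ e, ∫ x, f e x ∂μ e = 0)
    (hf : ∀ e j, 2 ≤ j → 1 ≤ ∫ x, f e x ^ j ∂μ e) (w : Fin (N + 1) → Fin n) :
    (if IsGoodWalk w then 1 else 0) ≤ (if w 0 = w (Fin.last N) then 1 else 0) *
      ∫ ω, ∏ i : Fin N,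
        symMatrix (fun e => f e (ω e)) (w i.castSucc) (w i.succ) ∂Measure.pi μ := by
  by_cases hc : w 0 = w (Fin.last N)
  swap
  · simp [hc, IsGoodWalk]
  rw [if_pos hc, one_mul]
  by_cases hw : ∀ i : Fin N, w i.castSucc ≠ w i.succ
  swap
  · rw [integral_walk_prod_of_loop _ _ _ hw, if_neg fun hg => hw fun i => (hg.2 i).1]
  rw [integral_walk_prod μ f w hw]
  by_cases hg : IsGoodWalk w
  · rw [if_pos hg]
    have hg' := ((isGoodWalk_iff w hw).1 hg).2
    have h1 : ∀ e, 1 ≤ ∫ x, f e x ^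
        (Finset.univ.filter fun i => walkEdge w hw i = e).card ∂μ e := by
      intro e
      by_cases he : ∃ i, walkEdge w hw i = e
      · obtain ⟨i, rfl⟩ := he
        exact hf _ _ (hg' i)
      · rw [Finset.card_eq_zero.2 (Finset.filter_eq_empty_iff.2 fun i _ hi => he ⟨i, hi⟩)]
        simp
    exact Finset.one_le_prod (fun e _ => h1 e)
  · rw [if_neg hg]
    rw [isGoodWalk_iff w hw] at hg
    push Not at hg
    obtain ⟨i, hi⟩ := hg hc
    refine (Finset.prod_eq_zero (Finset.mem_univ (walkEdge w hw i)) ?_).ge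
    have : 0 < (Finset.univ.filter fun j => walkEdge w hw j = walkEdge w hw i).card :=
      Finset.card_pos.2 ⟨i, by simp⟩
    rw [show (Finset.univ.filter fun j => walkEdge w hw j = walkEdge w hw i).card = 1 by omega]
    simpa using hf1 _

lemma integral_trace_pow {α : Type*} [MeasurableSpace α] [Finite α] [MeasurableSingletonClass α]
    (μ : Measure (NodePair n → α)) [IsFiniteMeasure μ] (f : NodePair n → α → ℝ) :
    ∫ ω, (symMatrix (fun e => f e (ω e)) ^ N).trace ∂μ =
      ∑ w : Fin (N + 1) → Fin n, (if w 0 = w (Fin.last N) then 1 else 0) *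
        ∫ ω, ∏ i : Fin N, symMatrix (fun e => f e (ω e)) (w i.castSucc) (w i.succ) ∂μ := by
  simp only [trace_pow_eq_sum_walk]
  rw [integral_finsetSum _ fun _ _ => Integrable.of_finite]
  simp only [integral_const_mul]

/-- Comparison of a sparse random matrix with a small dense one. -/
lemma integral_trace_pow_le {α β : Type*} {r : ℕ}
    [MeasurableSpace α] [Finite α] [MeasurableSingletonClass α]
    [MeasurableSpace β] [Finite β] [MeasurableSingletonClass β]
    (μ : NodePair n → Measure α) [∀ e, IsProbabilityMeasure (μ e)]
    (ν : NodePair r → Measure β) [∀ e, IsProbabilityMeasure (ν e)]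
    (f : NodePair n → α → ℝ) (g : NodePair r → β → ℝ) {p : ℝ} (hp0 : 0 < p) (hp1 : p ≤ 1)
    (hf1 : ∀ e, ∫ x, f e x ∂μ e = 0)
    (hf : ∀ e j, 2 ≤ j → |∫ x, f e x ^ j ∂μ e| ≤ p)
    (hg1 : ∀ e, ∫ x, g e x ∂ν e = 0)
    (hg : ∀ e j, 2 ≤ j → 1 ≤ ∫ x, g e x ^ j ∂ν e) (hr : n * p + N + 1 ≤ r) :
    ∫ ω, (symMatrix (fun e => f e (ω e)) ^ N).trace ∂Measure.pi μ ≤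
      p⁻¹ * ∫ ω, (symMatrix (fun e => g e (ω e)) ^ N).trace ∂Measure.pi ν := by
  classical
  rw [integral_trace_pow, integral_trace_pow]
  calc _ ≤ ∑ w : Fin (N + 1) → Fin n,
        p⁻¹ * (if IsGoodWalk w then p ^ (Finset.univ.image w).card else 0) :=
        Finset.sum_le_sum fun w _ => (integral_walk_le μ f hp0 hp1 hf1 hf w).trans (by
          gcongr)
    _ = p⁻¹ * ∑ w : Fin (N + 1) → Fin n,
        (if IsGoodWalk w then p ^ (Finset.univ.image w).card else 0) := by rw [Finset.mul_sum]
    _ ≤ p⁻¹ * ∑ w : Fin (N + 1) → Fin r, (if IsGoodWalk w then 1 else 0 : ℝ) := by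
        gcongr
        refine le_trans (le_of_eq ?_) (sum_goodWalk_le n r N p hp0.le hr)
        convert rfl
    _ ≤ _ := by
        gcongr with w
        exact le_integral_walk ν g hg1 hg w

end Walk

open scoped Matrix Matrix.Norms.L2Operator

/-! ### Lattice nets and the operator norm -/

/-- The integer points of square norm at most `K`. -/
def latticeBall (r K : ℕ) : Finset (Fin r → ℤ) :=
  (Fintype.piFinset fun _ => Finset.Icc (-(K : ℤ)) K).filter fun z => ∑ i, z i ^ 2 ≤ K

lemma mem_latticeBall {r K : ℕ} {z : Fin r → ℤ} :
    z ∈ latticeBall r K ↔ ∑ i, z i ^ 2 ≤ K := by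
  refine ⟨fun h => (Finset.mem_filter.1 h).2, fun h => Finset.mem_filter.2 ⟨?_, h⟩⟩
  refine Fintype.mem_piFinset.2 fun i => ?_
  have h1 : z i ^ 2 ≤ K :=
    (Finset.single_le_sum (f := fun i => z i ^ 2) (fun _ _ => sq_nonneg _)
      (Finset.mem_univ i)).trans h
  rw [Finset.mem_Icc]
  constructor <;> nlinarith [Int.le_self_sq (z i), Int.le_self_sq (-z i)]

lemma sum_half_pow_natAbs_le (K : ℕ) :
    ∑ z ∈ Finset.Icc (-(K : ℤ)) K, (1 / 2 : ℝ) ^ z.natAbs ≤ 4 := by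
  rw [Finset.sum_Icc_of_even_eq_range (fun z => by simp) K]
  have h : ∑ i ∈ Finset.range (K + 1), (1 / 2 : ℝ) ^ i ≤ 2 := by
    rw [geom_sum_eq (by norm_num)]
    have : (0 : ℝ) ≤ (1 / 2) ^ (K + 1) := by positivity
    rw [div_le_iff_of_neg (by norm_num)]
    linarith
  simp only [Int.natAbs_natCast, nsmul_eq_mul]
  norm_num at h ⊢
  linarith

/-- For integers `|z| ≤ z²`, so on the ball `1 ≤ 2^K ∏ 2^{-|zᵢ|}`. Extending this weight to the
whole box makes the sum factor over coordinates. -/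
lemma card_latticeBall_le (r K : ℕ) : ((latticeBall r K).card : ℝ) ≤ 2 ^ K * 4 ^ r := by
  calc ((latticeBall r K).card : ℝ) = ∑ z ∈ latticeBall r K, (1 : ℝ) := by simp
    _ ≤ ∑ z ∈ latticeBall r K, 2 ^ K * ∏ i, (1 / 2 : ℝ) ^ (z i).natAbs := by
        refine Finset.sum_le_sum fun z hz => ?_
        rw [Finset.prod_pow_eq_pow_sum]
        have h1 : ∑ i, (z i).natAbs ≤ K := by
          have h := mem_latticeBall.1 hz
          zify
          refine (Finset.sum_le_sum fun i _ => ?_).trans h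
          rw [← sq_abs]
          exact Int.le_self_sq _
        rw [one_div, inv_pow, ← div_eq_mul_inv, one_le_div (by positivity)]
        exact pow_le_pow_right₀ (by norm_num) h1
    _ ≤ ∑ z ∈ Fintype.piFinset fun _ : Fin r => Finset.Icc (-(K : ℤ)) K,
          2 ^ K * ∏ i, (1 / 2 : ℝ) ^ (z i).natAbs :=
        Finset.sum_le_sum_of_subset_of_nonneg (Finset.filter_subset _ _)
          fun _ _ _ => by positivity
    _ = 2 ^ K * ∏ _i : Fin r, ∑ z ∈ Finset.Icc (-(K : ℤ)) K, (1 / 2 : ℝ) ^ z.natAbs := by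
        rw [← Finset.mul_sum, Finset.prod_univ_sum]
    _ ≤ 2 ^ K * 4 ^ r := by
        gcongr
        calc _ ≤ ∏ _i : Fin r, (4 : ℝ) :=
              Finset.prod_le_prod (fun _ _ => Finset.sum_nonneg fun _ _ => by positivity)
                fun _ _ => sum_half_pow_natAbs_le K
          _ = 4 ^ r := by simp

/-- An integer point as a vector of Euclidean space. -/
def latticeVec {r : ℕ} (z : Fin r → ℤ) : EuclideanSpace ℝ (Fin r) :=
  WithLp.toLp 2 fun i => (z i : ℝ)

lemma norm_sq_latticeVec {r : ℕ} (z : Fin r → ℤ) :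
    ‖latticeVec z‖ ^ 2 = ∑ i, (z i : ℝ) ^ 2 := by
  simp [EuclideanSpace.norm_sq_eq, latticeVec]

/-- Rounding `4√r x` coordinatewise costs at most `√r / 2` in norm, and the rounded point has square
norm at most `(9/2)² r ≤ 21 r`. -/
lemma exists_latticeVec_near {r : ℕ} (hr : 0 < r) (x : EuclideanSpace ℝ (Fin r))
    (hx : ‖x‖ ≤ 1) :
    ∃ z ∈ latticeBall r (21 * r), ‖x - (4 * √r)⁻¹ • latticeVec z‖ ≤ 1 / 8 := by
  have hs : 0 < √(r : ℝ) := Real.sqrt_pos.2 (by exact_mod_cast hr)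
  have hsq : √(r : ℝ) ^ 2 = r := Real.sq_sqrt (Nat.cast_nonneg r)
  let z : Fin r → ℤ := fun i => round (4 * √r * x i)
  have h1 : ‖(4 * √r) • x - latticeVec z‖ ≤ √r / 2 := by
    refine (sq_le_sq₀ (norm_nonneg _) (by positivity)).1 ?_
    rw [EuclideanSpace.norm_sq_eq]
    calc _ ≤ ∑ _i : Fin r, (1 / 4 : ℝ) := by
          refine Finset.sum_le_sum fun i _ => ?_
          have := abs_sub_round (4 * √r * x i)
          have h2 : ((4 * √r) • x - latticeVec z) i = 4 * √r * x i - round (4 * √r * x i) := by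
            simp [latticeVec, z]
          rw [h2, Real.norm_eq_abs]
          nlinarith [abs_nonneg (4 * √r * x i - round (4 * √r * x i))]
      _ = (√r / 2) ^ 2 := by
          rw [div_pow, hsq]; simp; ring
  refine ⟨z, ?_, ?_⟩
  · have h2 : ‖latticeVec z‖ ≤ 4 * √r + √r / 2 := by
      calc ‖latticeVec z‖ = ‖(4 * √r) • x - ((4 * √r) • x - latticeVec z)‖ := by
            rw [sub_sub_cancel]
        _ ≤ ‖(4 * √r) • x‖ + ‖(4 * √r) • x - latticeVec z‖ := norm_sub_le _ _
        _ ≤ 4 * √r + √r / 2 := by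
            gcongr
            rw [norm_smul, Real.norm_of_nonneg (by positivity)]
            exact mul_le_of_le_one_right (by positivity) hx
    have h3 : ‖latticeVec z‖ ^ 2 ≤ 21 * r := by
      nlinarith [norm_nonneg (latticeVec z)]
    rw [norm_sq_latticeVec] at h3
    rw [mem_latticeBall]
    exact_mod_cast h3
  · have h2 : x - (4 * √r)⁻¹ • latticeVec z = (4 * √r)⁻¹ • ((4 * √r) • x - latticeVec z) := by
      rw [smul_sub, smul_smul, inv_mul_cancel₀ (by positivity), one_smul]
    rw [h2, norm_smul, Real.norm_of_nonneg (by positivity)]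
    calc _ ≤ (4 * √r)⁻¹ * (√r / 2) := by gcongr
      _ = 1 / 8 := by field_simp; norm_num

lemma opNorm_le_of_inner_le {E : Type*} [NormedAddCommGroup E] [InnerProductSpace ℝ E]
    (T : E →L[ℝ] E) {c : ℝ} (hc : 0 ≤ c)
    (h : ∀ x y, ‖x‖ ≤ 1 → ‖y‖ ≤ 1 → |inner ℝ y (T x)| ≤ c) : ‖T‖ ≤ c := by
  refine T.opNorm_le_of_unit_norm hc fun x hx => ?_
  by_cases h0 : T x = 0
  · simpa [h0] using hc
  have hn : ‖T x‖ ≠ 0 := norm_ne_zero_iff.2 h0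
  have h1 := h x (‖T x‖⁻¹ • T x) hx.le (by
    rw [norm_smul, norm_inv, norm_norm, inv_mul_cancel₀ hn])
  rw [real_inner_smul_left, real_inner_self_eq_norm_sq, sq, inv_mul_cancel_left₀ hn,
    abs_norm] at h1
  exact h1

lemma opNorm_le_of_latticeBall {r : ℕ} (hr : 0 < r)
    (T : EuclideanSpace ℝ (Fin r) →L[ℝ] EuclideanSpace ℝ (Fin r)) {S : ℝ}
    (h : ∀ z ∈ latticeBall r (21 * r), ∀ z' ∈ latticeBall r (21 * r),
      |inner ℝ (latticeVec z') (T (latticeVec z))| ≤ S) :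
    8 * r * ‖T‖ ≤ S := by
  have hr' : (0 : ℝ) < r := by exact_mod_cast hr
  have hs : 0 < √(r : ℝ) := Real.sqrt_pos.2 hr'
  have hsq : √(r : ℝ) ^ 2 = r := Real.sq_sqrt (Nat.cast_nonneg r)
  have hS : 0 ≤ S := (abs_nonneg _).trans
    (h 0 (mem_latticeBall.2 (by simp)) 0 (mem_latticeBall.2 (by simp)))
  -- Replacing both vectors by net points costs `1/8 + (9/8)(1/8) = 17/64` of `‖T‖`; the mesh
  -- factors contribute `(4√r)⁻² = 1/(16r)`.
  have key : ‖T‖ ≤ 17 / 64 * ‖T‖ + S / (16 * r) := by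
    refine opNorm_le_of_inner_le T (by positivity) fun x y hx hy => ?_
    obtain ⟨z, hz, hxz⟩ := exists_latticeVec_near hr x hx
    obtain ⟨z', hz', hyz⟩ := exists_latticeVec_near hr y hy
    set x' := (4 * √(r : ℝ))⁻¹ • latticeVec z with hx'
    set y' := (4 * √(r : ℝ))⁻¹ • latticeVec z' with hy'
    have hyn : ‖y'‖ ≤ 9 / 8 := by
      calc ‖y'‖ = ‖y - (y - y')‖ := by rw [sub_sub_cancel]
        _ ≤ ‖y‖ + ‖y - y'‖ := norm_sub_le _ _
        _ ≤ 9 / 8 := by linarith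
    have e : inner ℝ y (T x) =
        inner ℝ (y - y') (T x) + inner ℝ y' (T (x - x')) + inner ℝ y' (T x') := by
      rw [map_sub, inner_sub_left, inner_sub_right]; ring
    have b1 : |inner ℝ (y - y') (T x)| ≤ 1 / 8 * ‖T‖ := by
      refine (abs_real_inner_le_norm _ _).trans ?_
      gcongr
      exact (T.le_opNorm x).trans (mul_le_of_le_one_right (norm_nonneg _) hx)
    have b2 : |inner ℝ y' (T (x - x'))| ≤ 9 / 8 * (‖T‖ * (1 / 8)) := by
      refine (abs_real_inner_le_norm _ _).trans ?_
      gcongr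
      exact (T.le_opNorm _).trans (by gcongr)
    have b3 : |inner ℝ y' (T x')| ≤ S / (16 * r) := by
      rw [hx', hy', map_smul, real_inner_smul_left, real_inner_smul_right, abs_mul, abs_mul,
        abs_of_pos (by positivity : 0 < (4 * √(r : ℝ))⁻¹)]
      calc _ ≤ (4 * √(r : ℝ))⁻¹ * ((4 * √(r : ℝ))⁻¹ * S) := by
            gcongr
            exact h z hz z' hz'
        _ = S / (16 * √r ^ 2) := by field_simp; ring
        _ = _ := by rw [hsq]
    rw [e]
    refine (abs_add_three _ _ _).trans ?_
    linarith
  have h2 : S / (16 * r) * (16 * r) = S := by field_simp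
  nlinarith [norm_nonneg T]

/-! ### Bilinear forms of symmetric matrices -/

lemma symMatrix_eq_sum {n : ℕ} (x : NodePair n → ℝ) (i j : Fin n) :
    symMatrix x i j = ∑ e : NodePair n, ((if e.1 = (i, j) then x e else 0) +
      (if e.1 = (j, i) then x e else 0)) := by
  have h1 : ∀ i j : Fin n, ∑ e : NodePair n, (if e.1 = (i, j) then x e else 0) =
      if h : i < j then x ⟨(i, j), h⟩ else 0 := by
    intro i j
    split_ifs with h
    · rw [Finset.sum_eq_single (⟨(i, j), h⟩ : NodePair n)]
      · simp
      · intro e _ he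
        rw [if_neg fun h' => he (Subtype.ext h')]
      · simp
    · refine Finset.sum_eq_zero fun e _ => if_neg fun h' => h ?_
      have := e.2
      rwa [h'] at this
  rw [Finset.sum_add_distrib, h1, h1]
  unfold symMatrix
  rcases lt_trichotomy i j with h | h | h
  · simp [h, not_lt_of_gt h]
  · simp [h]
  · simp [h, not_lt_of_gt h]

lemma sum_mul_symMatrix {n : ℕ} (x : NodePair n → ℝ) (a b : Fin n → ℝ) :
    ∑ i, ∑ j, a i * symMatrix x i j * b j =
      ∑ e : NodePair n, (a e.1.1 * b e.1.2 + a e.1.2 * b e.1.1) * x e := by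
  simp only [symMatrix_eq_sum, Finset.mul_sum, Finset.sum_mul]
  rw [Finset.sum_congr rfl fun i _ => Finset.sum_comm, Finset.sum_comm]
  refine Finset.sum_congr rfl fun e _ => ?_
  simp only [mul_add, add_mul, Finset.sum_add_distrib, mul_ite, ite_mul, mul_zero, zero_mul,
    Prod.ext_iff, ite_and]
  simp
  ring

lemma inner_toEuclideanCLM_symMatrix {n : ℕ} (x : NodePair n → ℝ)
    (a b : EuclideanSpace ℝ (Fin n)) :
    inner ℝ a (Matrix.toEuclideanCLM (𝕜 := ℝ) (symMatrix x) b) =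
      ∑ e : NodePair n, (a e.1.1 * b e.1.2 + a e.1.2 * b e.1.1) * x e := by
  rw [← sum_mul_symMatrix, Matrix.inner_toEuclideanCLM]
  simp [dotProduct, Matrix.mulVec, Finset.mul_sum, mul_assoc]

lemma sum_sq_pair_le {n : ℕ} (a b : Fin n → ℝ) :
    ∑ e : NodePair n, (a e.1.1 * b e.1.2 + a e.1.2 * b e.1.1) ^ 2 ≤
      2 * ((∑ i, a i ^ 2) * ∑ i, b i ^ 2) := by
  have h := sum_mul_symMatrix (fun _ : NodePair n => (1 : ℝ)) (fun i => a i ^ 2)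
    fun i => b i ^ 2
  calc _ ≤ ∑ e : NodePair n,
        2 * ((a e.1.1 ^ 2 * b e.1.2 ^ 2 + a e.1.2 ^ 2 * b e.1.1 ^ 2) * 1) :=
        Finset.sum_le_sum fun e _ => by
          nlinarith [sq_nonneg (a e.1.1 * b e.1.2 - a e.1.2 * b e.1.1)]
    _ = 2 * ∑ i, ∑ j, a i ^ 2 * symMatrix (fun _ : NodePair n => (1 : ℝ)) i j * b j ^ 2 := by
        rw [h, Finset.mul_sum]
    _ ≤ 2 * ∑ i, ∑ j, a i ^ 2 * 1 * b j ^ 2 := by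
        gcongr with i _ j _
        by_cases hij : i = j
        · simp [hij]
        · rw [symMatrix_of_ne _ hij]
    _ = _ := by simp [Finset.sum_mul_sum]

/-! ### The dense comparison matrix -/

/-- The probability of the large value in the comparison model. -/
def third : unitInterval := ⟨1 / 3, by norm_num, by norm_num⟩

/-- The centred two-valued variable of the comparison model. -/
def skewValue (b : Bool) : ℝ := if b then 2 else -1

lemma integral_bernoulli_bool (p : unitInterval) (f : Bool → ℝ) :
    ∫ b, f b ∂(bernoulliMeasure true false p) = p * f true + (1 - p) * f false := by
  rw [bernoulliMeasure_def, integral_add_measure Integrable.of_finite Integrable.of_finite]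
  rw [integral_smul_nnreal_measure, integral_smul_nnreal_measure, integral_dirac, integral_dirac]
  simp [NNReal.smul_def]

lemma integral_skewValue : ∫ b, skewValue b ∂(bernoulliMeasure true false third) = 0 := by
  rw [integral_bernoulli_bool]; norm_num [third, skewValue]

/-- Odd moments must also be at least `1`, which rules out a symmetric sign. The skew two-point law
achieves this and stays bounded, hence subgaussian. -/
lemma one_le_integral_skewValue_pow {j : ℕ} (hj : 2 ≤ j) :
    1 ≤ ∫ b, skewValue b ^ j ∂(bernoulliMeasure true false third) := by
  rw [integral_bernoulli_bool]
  simp only [skewValue, third, if_true, Bool.false_eq_true, if_false]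
  have h2 : -1 ≤ (-1 : ℝ) ^ j := by
    rcases neg_one_pow_eq_or ℝ j with h | h <;> norm_num [h]
  rcases hj.eq_or_lt with rfl | h3
  · norm_num
  · have h4 : (2 : ℝ) ^ 3 ≤ 2 ^ j := pow_le_pow_right₀ (by norm_num) h3
    norm_num at h4 ⊢
    linarith

/-- Hoeffding's lemma on an interval of length `3`: the variance proxy is `9/4`. -/
lemma integral_exp_skewValue_le (t : ℝ) :
    ∫ b, Real.exp (t * skewValue b) ∂(bernoulliMeasure true false third) ≤
      Real.exp (9 / 8 * t ^ 2) := by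
  have h := (hasSubgaussianMGF_of_mem_Icc_of_integral_eq_zero (X := skewValue)
    (μ := bernoulliMeasure true false third) (a := -1) (b := 2)
    (measurable_of_finite _).aemeasurable
    (.of_forall fun b => by cases b <;> norm_num [skewValue]) integral_skewValue).mgf_le t
  refine h.trans (Real.exp_le_exp.2 (le_of_eq ?_))
  push_cast
  norm_num
  ring

/-- The law of the comparison model. -/
abbrev skewLaw (r : ℕ) : Measure (NodePair r → Bool) :=
  Measure.pi fun _ => bernoulliMeasure true false third

/-- The comparison matrix. -/
def skewMatrix {r : ℕ} (ω : NodePair r → Bool) : Matrix (Fin r) (Fin r) ℝ :=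
  symMatrix fun e => skewValue (ω e)

lemma integral_exp_sum_skewValue_le {r : ℕ} (a : NodePair r → ℝ) :
    ∫ ω, Real.exp (∑ e, a e * skewValue (ω e)) ∂skewLaw r ≤
      Real.exp (9 / 8 * ∑ e, a e ^ 2) := by
  simp only [Real.exp_sum, Finset.mul_sum]
  rw [integral_fintype_prod_eq_prod (𝕜 := ℝ) fun e b => Real.exp (a e * skewValue b)]
  exact Finset.prod_le_prod (fun _ _ => integral_nonneg fun _ => (Real.exp_pos _).le)
    fun e _ => integral_exp_skewValue_le _

lemma pow_le_factorial_mul_exp (y : ℝ) {s : ℝ} (hs : 0 < s) {N : ℕ} (hN : Even N) :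
    y ^ N ≤ N.factorial * (s⁻¹) ^ N * (Real.exp (s * y) + Real.exp (-s * y)) := by
  have h1 := Real.pow_div_factorial_le_exp |s * y| (abs_nonneg _) N
  rw [div_le_iff₀ (by positivity), hN.pow_abs, mul_pow] at h1
  have h2 : Real.exp |s * y| ≤ Real.exp (s * y) + Real.exp (-s * y) := by
    rcases abs_choice (s * y) with h | h <;> rw [h]
    · linarith [Real.exp_pos (-s * y)]
    · rw [← neg_mul]; linarith [Real.exp_pos (s * y)]
  have h3 : y ^ N = (s⁻¹) ^ N * (s ^ N * y ^ N) := by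
    rw [inv_pow, inv_mul_cancel_left₀ (by positivity)]
  rw [h3, mul_comm (N.factorial : ℝ), mul_assoc]
  refine mul_le_mul_of_nonneg_left (h1.trans ?_) (by positivity)
  rw [mul_comm]
  gcongr

/-- The bilinear form is a subgaussian sum whose coefficients have square sum at most `2 (21 r)² =
882 r²`. Exponential moments at `± r^{-1/2}` are then at most `exp(992.25 r)`, and they dominate the
`N`-th moment. -/
lemma integral_inner_skewMatrix_pow_le {r N : ℕ} (hr : 0 < r) (hN : Even N)
    {z z' : Fin r → ℤ} (hz : z ∈ latticeBall r (21 * r)) (hz' : z' ∈ latticeBall r (21 * r)) :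
    ∫ ω, inner ℝ (latticeVec z') (Matrix.toEuclideanCLM (𝕜 := ℝ) (skewMatrix ω)
        (latticeVec z)) ^ N ∂skewLaw r ≤
      N.factorial * √r ^ N * (2 * Real.exp (1000 * r)) := by
  have hr' : (0 : ℝ) < r := by exact_mod_cast hr
  have hs : 0 < √(r : ℝ) := Real.sqrt_pos.2 hr'
  have hsq : √(r : ℝ) ^ 2 = r := Real.sq_sqrt (Nat.cast_nonneg r)
  set a : NodePair r → ℝ := fun e => (z' e.1.1 : ℝ) * z e.1.2 + z' e.1.2 * z e.1.1
  have hY : ∀ ω, inner ℝ (latticeVec z') (Matrix.toEuclideanCLM (𝕜 := ℝ) (skewMatrix ω)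
      (latticeVec z)) = ∑ e, a e * skewValue (ω e) := fun ω =>
    inner_toEuclideanCLM_symMatrix _ _ _
  simp only [hY]
  have hball : ∀ {u : Fin r → ℤ}, u ∈ latticeBall r (21 * r) →
      ∑ i, (u i : ℝ) ^ 2 ≤ 21 * r := fun hu => by exact_mod_cast mem_latticeBall.1 hu
  have ha : ∑ e, a e ^ 2 ≤ 882 * r ^ 2 := by
    refine (sum_sq_pair_le (fun i => (z' i : ℝ)) fun i => (z i : ℝ)).trans ?_
    calc _ ≤ 2 * ((21 * r : ℝ) * (21 * r)) := by
          gcongr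
          · exact hball hz'
          · exact hball hz
      _ = _ := by ring
  have hexp : ∀ t : ℝ, t ^ 2 = (r : ℝ)⁻¹ →
      ∫ ω, Real.exp (t * ∑ e, a e * skewValue (ω e)) ∂skewLaw r ≤ Real.exp (1000 * r) := by
    intro t ht
    have h := integral_exp_sum_skewValue_le fun e => t * a e
    simp only [mul_assoc, mul_pow, ← Finset.mul_sum] at h ⊢
    refine h.trans (Real.exp_le_exp.2 ?_)
    rw [ht]
    calc 9 / 8 * ((r : ℝ)⁻¹ * ∑ e, a e ^ 2) ≤ 9 / 8 * ((r : ℝ)⁻¹ * (882 * r ^ 2)) := by gcongr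
      _ = 992.25 * r := by field_simp; norm_num
      _ ≤ _ := by nlinarith
  calc _ ≤ ∫ ω, N.factorial * ((√r)⁻¹⁻¹) ^ N *
        (Real.exp ((√r)⁻¹ * ∑ e, a e * skewValue (ω e)) +
          Real.exp (-(√r)⁻¹ * ∑ e, a e * skewValue (ω e))) ∂skewLaw r :=
        integral_mono Integrable.of_finite Integrable.of_finite fun ω =>
          pow_le_factorial_mul_exp _ (by positivity) hN
    _ = N.factorial * √r ^ N *
        (∫ ω, Real.exp ((√r)⁻¹ * ∑ e, a e * skewValue (ω e)) ∂skewLaw r +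
          ∫ ω, Real.exp (-(√r)⁻¹ * ∑ e, a e * skewValue (ω e)) ∂skewLaw r) := by
        rw [integral_const_mul, inv_inv, integral_add Integrable.of_finite Integrable.of_finite]
    _ ≤ _ := by
        gcongr
        rw [two_mul]
        exact add_le_add (hexp _ (by rw [inv_pow, hsq])) (hexp _ (by rw [neg_sq, inv_pow, hsq]))

lemma abs_apply_le_norm {n : ℕ} (M : Matrix (Fin n) (Fin n) ℝ) (i j : Fin n) :
    |M i j| ≤ ‖M‖ := by
  have h := Matrix.l2_opNorm_mulVec M (EuclideanSpace.single j 1)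
  have h2 := PiLp.norm_apply_le (WithLp.toLp 2 (M *ᵥ (EuclideanSpace.single j (1 : ℝ)).ofLp)) i
  simp at h h2
  exact h2.trans h

lemma trace_pow_le {n : ℕ} (M : Matrix (Fin n) (Fin n) ℝ) {N : ℕ} (hN : 0 < N) :
    (M ^ N).trace ≤ n * ‖M‖ ^ N := by
  calc (M ^ N).trace ≤ ∑ _i : Fin n, ‖M‖ ^ N := by
        refine Finset.sum_le_sum fun i _ => ?_
        exact (le_abs_self _).trans ((abs_apply_le_norm _ i i).trans (norm_pow_le' M hN))
    _ = _ := by simp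

/-- The maximum over the net is bounded by the sum, all terms being nonnegative even powers;
expectations can then be taken term by term. -/
lemma norm_pow_skewMatrix_le {r N : ℕ} (hr : 0 < r) (hN : Even N) (ω : NodePair r → Bool) :
    (8 * r * ‖skewMatrix ω‖) ^ N ≤ ∑ z ∈ latticeBall r (21 * r), ∑ z' ∈ latticeBall r (21 * r),
      inner ℝ (latticeVec z') (Matrix.toEuclideanCLM (𝕜 := ℝ) (skewMatrix ω)
        (latticeVec z)) ^ N := by
  rw [← Finset.sum_product']
  obtain ⟨m, hm, hmax⟩ := Finset.exists_max_image
    (latticeBall r (21 * r) ×ˢ latticeBall r (21 * r))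
    (fun m => |inner ℝ (latticeVec m.2) (Matrix.toEuclideanCLM (𝕜 := ℝ) (skewMatrix ω)
        (latticeVec m.1))|)
    ⟨(0, 0), Finset.mem_product.2 ⟨mem_latticeBall.2 (by simp), mem_latticeBall.2 (by simp)⟩⟩
  have h1 := opNorm_le_of_latticeBall hr (Matrix.toEuclideanCLM (𝕜 := ℝ) (skewMatrix ω))
    fun z hz z' hz' => hmax (z, z') (Finset.mem_product.2 ⟨hz, hz'⟩)
  rw [← Matrix.cstar_norm_def] at h1
  calc _ ≤ |inner ℝ (latticeVec m.2) (Matrix.toEuclideanCLM (𝕜 := ℝ) (skewMatrix ω)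
        (latticeVec m.1))| ^ N := by gcongr
    _ = inner ℝ (latticeVec m.2) (Matrix.toEuclideanCLM (𝕜 := ℝ) (skewMatrix ω)
        (latticeVec m.1)) ^ N := hN.pow_abs _
    _ ≤ _ := Finset.single_le_sum (f := fun m : (Fin r → ℤ) × (Fin r → ℤ) =>
        inner ℝ (latticeVec m.2) (Matrix.toEuclideanCLM (𝕜 := ℝ) (skewMatrix ω)
          (latticeVec m.1)) ^ N) (fun _ _ => hN.pow_nonneg _) hm

/-- The expected trace of an even power of the comparison matrix. -/
lemma integral_trace_skewMatrix_le {r N : ℕ} (hN0 : 0 < N) (hN : Even N) (hr : N ≤ r) :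
    ∫ ω, (skewMatrix ω ^ N).trace ∂skewLaw r ≤ 2 * r * √r ^ N * Real.exp (1046 * r) := by
  have hr0 : 0 < r := hN0.trans_le hr
  have hr' : (0 : ℝ) < r := by exact_mod_cast hr0
  have h1 : ∫ ω, (8 * r * ‖skewMatrix ω‖) ^ N ∂skewLaw r ≤
      ((latticeBall r (21 * r)).card : ℝ) ^ 2 *
        (N.factorial * √r ^ N * (2 * Real.exp (1000 * r))) := by
    calc _ ≤ ∫ ω, ∑ z ∈ latticeBall r (21 * r), ∑ z' ∈ latticeBall r (21 * r),
          inner ℝ (latticeVec z') (Matrix.toEuclideanCLM (𝕜 := ℝ) (skewMatrix ω)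
            (latticeVec z)) ^ N ∂skewLaw r :=
          integral_mono Integrable.of_finite Integrable.of_finite
            fun ω => norm_pow_skewMatrix_le hr0 hN ω
      _ = ∑ z ∈ latticeBall r (21 * r), ∑ z' ∈ latticeBall r (21 * r),
          ∫ ω, inner ℝ (latticeVec z') (Matrix.toEuclideanCLM (𝕜 := ℝ) (skewMatrix ω)
            (latticeVec z)) ^ N ∂skewLaw r := by
          rw [integral_finsetSum _ fun _ _ => Integrable.of_finite]
          refine Finset.sum_congr rfl fun z _ => ?_
          rw [integral_finsetSum _ fun _ _ => Integrable.of_finite]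
      _ ≤ ∑ _z ∈ latticeBall r (21 * r), ∑ _z' ∈ latticeBall r (21 * r),
          (N.factorial * √r ^ N * (2 * Real.exp (1000 * r))) :=
          Finset.sum_le_sum fun z hz => Finset.sum_le_sum fun z' hz' =>
            integral_inner_skewMatrix_pow_le hr0 hN hz hz'
      _ = _ := by simp only [Finset.sum_const, nsmul_eq_mul]; ring
  have h2 : ((latticeBall r (21 * r)).card : ℝ) ^ 2 ≤ Real.exp (46 * r) := by
    calc ((latticeBall r (21 * r)).card : ℝ) ^ 2 ≤ (2 ^ (21 * r) * 4 ^ r) ^ 2 := by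
          gcongr; exact card_latticeBall_le _ _
      _ = 2 ^ (46 * r) := by
          rw [show (4 : ℝ) = 2 ^ 2 by norm_num, ← pow_mul, ← pow_add, ← pow_mul]; congr 1; ring
      _ ≤ Real.exp 1 ^ (46 * r) := by
          gcongr; linarith [Real.add_one_le_exp (1 : ℝ)]
      _ = Real.exp (46 * r) := by rw [← Real.exp_nat_mul]; push_cast; ring_nf
  -- This is where `N ≤ r` enters: the factorial is cancelled by the factor `r^N` that the net
  -- argument puts on the left.
  have h3 : (N.factorial : ℝ) ≤ (r : ℝ) ^ N := by
    exact_mod_cast (Nat.factorial_le_pow N).trans (Nat.pow_le_pow_left hr N)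
  have h4 : ∫ ω, ‖skewMatrix ω‖ ^ N ∂skewLaw r ≤ √r ^ N * 2 * Real.exp (1046 * r) := by
    have h5 : (r : ℝ) ^ N * ∫ ω, ‖skewMatrix ω‖ ^ N ∂skewLaw r ≤
        (r : ℝ) ^ N * (√r ^ N * 2 * Real.exp (1046 * r)) := by
      calc _ = ∫ ω, (r * ‖skewMatrix ω‖) ^ N ∂skewLaw r := by
            simp only [mul_pow]; rw [integral_const_mul]
        _ ≤ ∫ ω, (8 * r * ‖skewMatrix ω‖) ^ N ∂skewLaw r :=
            integral_mono Integrable.of_finite Integrable.of_finite fun ω => by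
              dsimp only
              gcongr
              linarith
        _ ≤ _ := h1
        _ ≤ Real.exp (46 * r) * ((r : ℝ) ^ N * √r ^ N * (2 * Real.exp (1000 * r))) := by
            gcongr
        _ = (r : ℝ) ^ N * (√r ^ N * 2 * Real.exp (46 * r + 1000 * r)) := by
            rw [Real.exp_add]; ring
        _ = _ := by ring_nf
    exact le_of_mul_le_mul_left h5 (by positivity)
  calc _ ≤ ∫ ω, r * ‖skewMatrix ω‖ ^ N ∂skewLaw r :=
        integral_mono Integrable.of_finite Integrable.of_finite fun ω => trace_pow_le _ hN0
    _ = r * ∫ ω, ‖skewMatrix ω‖ ^ N ∂skewLaw r := integral_const_mul _ _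
    _ ≤ r * (√r ^ N * 2 * Real.exp (1046 * r)) := by gcongr
    _ = _ := by ring

/-! ### Concentration of the operator norm -/

lemma norm_sq_le_sum_sq {n : ℕ} (M : Matrix (Fin n) (Fin n) ℝ) :
    ‖M‖ ^ 2 ≤ ∑ i, ∑ j, M i j ^ 2 := by
  have h0 : 0 ≤ ∑ i, ∑ j, M i j ^ 2 := by positivity
  refine (Real.le_sqrt (norm_nonneg _) h0).1 ?_
  rw [Matrix.cstar_norm_def]
  refine ContinuousLinearMap.opNorm_le_bound _ (Real.sqrt_nonneg _) fun x => ?_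
  refine (sq_le_sq₀ (norm_nonneg _) (by positivity)).1 ?_
  rw [mul_pow, Real.sq_sqrt h0, EuclideanSpace.norm_sq_eq, EuclideanSpace.norm_sq_eq,
    Finset.sum_mul]
  refine Finset.sum_le_sum fun i _ => ?_
  simp only [Matrix.ofLp_toEuclideanCLM, Matrix.mulVec, dotProduct, Real.norm_eq_abs, sq_abs]
  exact Finset.sum_mul_sq_le_sq_mul_sq _ _ _

/-- Powers of two let the C*-identity give `‖M‖^(2^a) = ‖M^(2^a)‖` without diagonalization. Squaring
and bounding by the Hilbert–Schmidt norm produces the trace. -/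
lemma norm_pow_le_trace {n : ℕ} {M : Matrix (Fin n) (Fin n) ℝ} (hM : Mᵀ = M) (a : ℕ) :
    ‖M‖ ^ 2 ^ (a + 1) ≤ (M ^ 2 ^ (a + 1)).trace := by
  have hsa : IsSelfAdjoint M := by
    rw [IsSelfAdjoint, Matrix.star_eq_conjTranspose, Matrix.conjTranspose_eq_transpose_of_trivial,
      hM]
  have h1 := hsa.norm_pow_two_pow a
  rw [pow_succ, pow_mul, ← h1, pow_mul]
  refine (norm_sq_le_sum_sq _).trans (le_of_eq ?_)
  have h2 : (M ^ 2 ^ a)ᵀ = M ^ 2 ^ a := by rw [Matrix.transpose_pow, hM]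
  conv_rhs => rw [sq, Matrix.trace]
  simp only [Matrix.diag_apply, Matrix.mul_apply]
  refine Finset.sum_congr rfl fun i _ => Finset.sum_congr rfl fun j _ => ?_
  conv_rhs => rw [← congrFun₂ h2 j i, Matrix.transpose_apply]
  rw [sq]

lemma symMatrix_transpose {n : ℕ} (x : NodePair n → ℝ) : (symMatrix x)ᵀ = symMatrix x := by
  ext i j
  exact symMatrix_comm x j i

lemma abs_integral_pow_le {α : Type*} [MeasurableSpace α] [Finite α] [MeasurableSingletonClass α]
    (μ : Measure α) [IsProbabilityMeasure μ] {f : α → ℝ} {p : ℝ} (hb : ∀ x, |f x| ≤ 1)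
    (h2 : ∫ x, f x ^ 2 ∂μ ≤ p) {j : ℕ} (hj : 2 ≤ j) : |∫ x, f x ^ j ∂μ| ≤ p := by
  refine (abs_integral_le_integral_abs).trans (le_trans ?_ h2)
  refine integral_mono Integrable.of_finite Integrable.of_finite fun x => ?_
  dsimp only
  rw [abs_pow, ← sq_abs (f x)]
  exact pow_le_pow_of_le_one (abs_nonneg _) (hb x) hj

/-- A moment bound for the tail of the norm of a sparse random matrix. -/
lemma measure_norm_symMatrix_mul_le {α : Type*} {n r a : ℕ}
    [MeasurableSpace α] [Finite α] [MeasurableSingletonClass α]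
    (μ : NodePair n → Measure α) [∀ e, IsProbabilityMeasure (μ e)]
    (f : NodePair n → α → ℝ) {p : ℝ} (hp0 : 0 < p) (hp1 : p ≤ 1)
    (hb : ∀ e x, |f e x| ≤ 1) (hf1 : ∀ e, ∫ x, f e x ∂μ e = 0)
    (hf2 : ∀ e, ∫ x, f e x ^ 2 ∂μ e ≤ p) (hr : n * p + (2 ^ (a + 1) : ℕ) + 1 ≤ r)
    {T : ℝ} (hT : 0 ≤ T) :
    T ^ 2 ^ (a + 1) * (Measure.pi μ).real {ω | T < ‖symMatrix fun e => f e (ω e)‖} ≤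
      p⁻¹ * (2 * r * √r ^ 2 ^ (a + 1) * Real.exp (1046 * r)) := by
  have hN0 : 0 < 2 ^ (a + 1) := by positivity
  have hN : Even (2 ^ (a + 1)) := by simp [pow_succ]
  have hNr : 2 ^ (a + 1) ≤ r := by
    have : ((2 ^ (a + 1) : ℕ) : ℝ) ≤ r := by
      nlinarith [mul_nonneg (Nat.cast_nonneg (α := ℝ) n) hp0.le]
    exact_mod_cast this
  calc _ ≤ T ^ 2 ^ (a + 1) * (Measure.pi μ).real
        {ω | T ^ 2 ^ (a + 1) ≤ (symMatrix (fun e => f e (ω e)) ^ 2 ^ (a + 1)).trace} := by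
        refine mul_le_mul_of_nonneg_left
          (measureReal_mono (fun ω (hω : T < _) => ?_) (measure_ne_top _ _)) (by positivity)
        exact (pow_le_pow_left₀ hT hω.le _).trans (norm_pow_le_trace (symMatrix_transpose _) a)
    _ ≤ ∫ ω, (symMatrix (fun e => f e (ω e)) ^ 2 ^ (a + 1)).trace ∂Measure.pi μ :=
        mul_meas_ge_le_integral_of_nonneg (.of_forall fun ω =>
          (by positivity : (0 : ℝ) ≤ _).trans (norm_pow_le_trace (symMatrix_transpose _) a))
          Integrable.of_finite _
    _ ≤ p⁻¹ * ∫ ω, (skewMatrix ω ^ 2 ^ (a + 1)).trace ∂skewLaw r :=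
        integral_trace_pow_le μ _ f (fun _ => skewValue) hp0 hp1 hf1
          (fun e j hj => abs_integral_pow_le (μ e) (hb e) (hf2 e) hj)
          (fun _ => integral_skewValue) (fun _ _ hj => one_le_integral_skewValue_pow hj) hr
    _ ≤ _ := by
        gcongr
        exact integral_trace_skewMatrix_le hN0 hN hNr

lemma one_le_log_natCast {k : ℕ} (hk : 3 ≤ k) : 1 ≤ Real.log k := by
  have h3 : (3 : ℝ) ≤ k := by exact_mod_cast hk
  rw [Real.le_log_iff_exp_le (by linarith)]
  linarith [Real.exp_one_lt_d9]

/-- The norm of a centred random symmetric matrix with independent entries of variance at most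
`p` is of order `√(log k)` in the logarithmic regime. -/
theorem exists_norm_symMatrix_bound (Γ : ℝ) (hΓ : 0 < Γ) :
    ∃ B : ℝ, 0 < B ∧ ∃ K : ℕ, ∀ k : ℕ, K ≤ k → ∀ {α : Type}
      [MeasurableSpace α] [Finite α] [MeasurableSingletonClass α]
      (μ : NodePair (2 * k) → Measure α) [∀ e, IsProbabilityMeasure (μ e)]
      (f : NodePair (2 * k) → α → ℝ) (p : ℝ), (k : ℝ)⁻¹ ≤ p → p ≤ 1 →
      2 * k * p ≤ Γ * Real.log k → (∀ e x, |f e x| ≤ 1) → (∀ e, ∫ x, f e x ∂μ e = 0) →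
      (∀ e, ∫ x, f e x ^ 2 ∂μ e ≤ p) →
      (Measure.pi μ).real {ω | √(B * Real.log k) < ‖symMatrix fun e => f e (ω e)‖} ≤
        (k : ℝ)⁻¹ := by
  -- The constant in `r ≤ c log k`: `Γ` from `np`, `8` from `N`, and `2` from the ceiling and the
  -- extra one.
  set c := Γ + 10 with hc
  have hc0 : 0 < c := by positivity
  -- As `N ≥ 4 log k`, the gain `exp(Nβ)` absorbs `exp(1046 r)` and leaves `exp(4 log k) = k⁴`, to
  -- beat `p⁻¹ ≤ k` and the factor `2r`.
  set β := 1046 * c / 4 + 1 with hβ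
  refine ⟨c * Real.exp (2 * β), by positivity, max 3 ⌈2 * c⌉₊, ?_⟩
  intro k hk α _ _ _ μ _ f p hkp hp1 hnp hb hf1 hf2
  have hk3 : 3 ≤ k := (le_max_left _ _).trans hk
  have hkc : 2 * c ≤ k := (Nat.le_ceil _).trans (by exact_mod_cast (le_max_right _ _).trans hk)
  have hk0 : (0 : ℝ) < k := by positivity
  have hlog := one_le_log_natCast hk3
  set l := Real.log k with hl
  have hl0 : 0 < l := by linarith
  have hp0 : 0 < p := (inv_pos.2 hk0).trans_le hkp
  -- The power has to be a power of two; this places it between `4 log k` and `8 log k`.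
  obtain ⟨a, ha1, ha2⟩ := exists_nat_pow_near (x := 2 * l) (y := 2) (by linarith) (by norm_num)
  set N := 2 ^ (a + 1 + 1) with hN
  have hN1 : (N : ℝ) ≤ 8 * l := by rw [hN]; push_cast; rw [pow_succ, pow_succ]; linarith
  have hN2 : 4 * l ≤ N := by rw [hN]; push_cast; rw [pow_succ]; linarith
  set r := ⌈((2 * k : ℕ) : ℝ) * p⌉₊ + N + 1 with hr
  have hr1 : ((2 * k : ℕ) : ℝ) * p + (N : ℕ) + 1 ≤ r := by
    rw [hr]; push_cast
    have := Nat.le_ceil (2 * (k : ℝ) * p)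
    linarith
  have hr2 : (r : ℝ) ≤ c * l := by
    rw [hr, hc]; push_cast
    have := Nat.ceil_lt_add_one (a := 2 * (k : ℝ) * p) (by positivity)
    nlinarith
  have hr0 : (0 : ℝ) < r := by rw [hr]; positivity
  set T := √(c * Real.exp (2 * β) * l) with hT
  have hT0 : 0 < T := Real.sqrt_pos.2 (by positivity)
  have main := measure_norm_symMatrix_mul_le (r := r) (a := a + 1) μ f hp0 hp1 hb hf1 hf2 hr1
    hT0.le
  set P := (Measure.pi μ).real {ω | T < ‖symMatrix fun e => f e (ω e)‖} with hP
  have hP0 : 0 ≤ P := measureReal_nonneg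
  have hTr : Real.exp β * √r ≤ T := by
    rw [hT]
    refine Real.le_sqrt_of_sq_le ?_
    rw [mul_pow, Real.sq_sqrt hr0.le, ← Real.exp_nat_mul]
    push_cast
    calc _ ≤ Real.exp (2 * β) * (c * l) := by gcongr
      _ = _ := by ring
  have h1 : Real.exp (4 * β * l) * P ≤ p⁻¹ * (2 * r * Real.exp (1046 * r)) := by
    have h2 : √(r : ℝ) ^ N * (Real.exp (4 * β * l) * P) ≤
        √(r : ℝ) ^ N * (p⁻¹ * (2 * r * Real.exp (1046 * r))) := by
      calc _ = Real.exp (4 * β * l) * √(r : ℝ) ^ N * P := by ring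
        _ ≤ Real.exp (N * β) * √(r : ℝ) ^ N * P := by
            gcongr ?_ * _ * _
            refine Real.exp_le_exp.2 ?_
            have : 0 ≤ β := by positivity
            nlinarith
        _ = (Real.exp β * √(r : ℝ)) ^ N * P := by rw [mul_pow, ← Real.exp_nat_mul]
        _ ≤ T ^ N * P := by gcongr
        _ ≤ _ := main
        _ = _ := by ring
    exact le_of_mul_le_mul_left h2 (by positivity)
  have h3 : Real.exp (4 * l) * P ≤ k * (2 * (c * l)) := by
    have h2 : Real.exp (1046 * (c * l)) * (Real.exp (4 * l) * P) ≤
        Real.exp (1046 * (c * l)) * (k * (2 * (c * l))) := by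
      calc _ = Real.exp (4 * β * l) * P := by
            rw [← mul_assoc, ← Real.exp_add, hβ]; congr 2; ring
        _ ≤ _ := h1
        _ ≤ (k : ℝ) * (2 * (c * l) * Real.exp (1046 * (c * l))) := by
            gcongr
            exact inv_le_of_inv_le₀ hk0 hkp
        _ = _ := by ring
    exact le_of_mul_le_mul_left h2 (Real.exp_pos _)
  have h4 : Real.exp (4 * l) = (k : ℝ) ^ 4 := by
    rw [show (4 : ℝ) = (4 : ℕ) by norm_num, Real.exp_nat_mul, hl, Real.exp_log hk0]
  have h5 : l ≤ k := (Real.log_le_sub_one_of_pos hk0).trans (by linarith)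
  rw [h4] at h3
  have h6 : (k : ℝ) ^ 3 * (k * P) ≤ (k : ℝ) ^ 3 * 1 := by
    calc _ = (k : ℝ) ^ 4 * P := by ring
      _ ≤ k * (2 * (c * l)) := h3
      _ = k * (2 * c * l) := by ring
      _ ≤ k * (k * k) := by gcongr
      _ = _ := by ring
  have h7 := le_of_mul_le_mul_left h6 (by positivity)
  rw [← one_div, le_div_iff₀ hk0]
  linarith

/-! ### Perturbation of the least eigenvector -/

section Perturbation

variable {E : Type*} [NormedAddCommGroup E] [InnerProductSpace ℝ E]

/-- The form of `1 - T` is within `ε` of a form with top eigenvector `u` and second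
eigenvector `o`. -/
def IsNearSpike (T : E →ₗ[ℝ] E) (u o : E) (θ ρ ε : ℝ) : Prop :=
  ∀ x y, |inner ℝ x y - inner ℝ x (T y) -
    θ * (inner ℝ u x * inner ℝ u y + ρ * (inner ℝ o x * inner ℝ o y))| ≤ ε * ‖x‖ * ‖y‖

variable {T : E →ₗ[ℝ] E} {u o : E} {θ ρ ε t : ℝ}

/-- Testing the form at `(u, u)` gives `1 - t ≥ θ - ε`. Testing at `(w, x)`, with `w` the part of
`x` orthogonal to `u`, gives `(1 - t)‖w‖² - θρ⟨o, w⟩² ≤ ε‖w‖‖x‖`. Together they leave a coefficient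
of at least half the gap. -/
lemma IsNearSpike.norm_orth_le (h : IsNearSpike T u o θ ρ ε) (hu : ‖u‖ = 1) (ho : ‖o‖ = 1)
    (huo : inner ℝ u o = 0) (hθ : 0 < θ) (hρ0 : 0 ≤ ρ) (hε : ε ≤ θ * (1 - ρ) / 4)
    (hε0 : 0 ≤ ε) (ht : t ≤ inner ℝ u (T u)) {x : E} (hx : T x = t • x) :
    θ * (1 - ρ) / 2 * ‖x - inner ℝ u x • u‖ ≤ ε * ‖x‖ := by
  set w := x - inner ℝ u x • u with hw
  have huu : inner ℝ u u = 1 := by rw [real_inner_self_eq_norm_sq, hu, one_pow]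
  have hou : inner ℝ o u = 0 := by rw [real_inner_comm, huo]
  have huw : inner ℝ u w = 0 := by
    rw [hw, inner_sub_right, real_inner_smul_right, huu]; ring
  have how : inner ℝ o w = inner ℝ o x := by
    rw [hw, inner_sub_right, real_inner_smul_right, hou]; ring
  have hwx : inner ℝ w x = ‖w‖ ^ 2 := by
    have : x = w + inner ℝ u x • u := by rw [hw]; abel
    conv_lhs => rw [this]
    rw [inner_add_right, real_inner_smul_right, real_inner_comm u w, huw,
      real_inner_self_eq_norm_sq]
    ring
  have h1 := (abs_le.1 (h u u)).1
  rw [huu, hou, hu] at h1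
  have h2 := (abs_le.1 (h w x)).2
  rw [hx, real_inner_smul_right, hwx, huw, ← how] at h2
  have h3 : inner ℝ o w * inner ℝ o w ≤ ‖w‖ ^ 2 := by
    have := abs_real_inner_le_norm o w
    rw [ho, one_mul] at this
    rw [← sq, ← sq_abs]
    exact pow_le_pow_left₀ (abs_nonneg _) this 2
  have h4 : (θ * (1 - ρ) / 2) * ‖w‖ ^ 2 ≤ ε * ‖w‖ * ‖x‖ := by
    have h5 : θ * ρ * (inner ℝ o w * inner ℝ o w) ≤ θ * ρ * ‖w‖ ^ 2 := by gcongr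
    have h6 : (θ - ε) * ‖w‖ ^ 2 ≤ (1 - t) * ‖w‖ ^ 2 :=
      mul_le_mul_of_nonneg_right (by linarith) (by positivity)
    have h7 : ε * ‖w‖ ^ 2 ≤ θ * (1 - ρ) / 4 * ‖w‖ ^ 2 := by gcongr
    have h8 : 0 ≤ θ * (1 - ρ) / 4 * ‖w‖ ^ 2 := by
      have := hε0.trans hε
      positivity
    nlinarith
  rcases (norm_nonneg w).eq_or_lt with h0 | h0
  · rw [← h0]
    have := mul_nonneg hε0 (norm_nonneg x)
    simpa using this
  · refine le_of_mul_le_mul_left ?_ h0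
    nlinarith

lemma IsNearSpike.eq_zero_of_inner_eq_zero (h : IsNearSpike T u o θ ρ ε) (hu : ‖u‖ = 1)
    (ho : ‖o‖ = 1) (huo : inner ℝ u o = 0) (hθ : 0 < θ) (hρ0 : 0 ≤ ρ) (hρ1 : ρ < 1)
    (hε : ε ≤ θ * (1 - ρ) / 4) (hε0 : 0 ≤ ε) (ht : t ≤ inner ℝ u (T u)) {x : E}
    (hx : T x = t • x) (hux : inner ℝ u x = 0) : x = 0 := by
  have h1 := h.norm_orth_le hu ho huo hθ hρ0 hε hε0 ht hx
  rw [hux, zero_smul, sub_zero] at h1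
  have h2 : 0 < θ * (1 - ρ) := mul_pos hθ (by linarith)
  by_contra h0
  have := norm_pos_iff.2 h0
  nlinarith

/-- An eigenvector orthogonal to `u` must vanish, so the `u`-coordinate is injective on the
eigenspace. -/
lemma IsNearSpike.finrank_eigenspace (h : IsNearSpike T u o θ ρ ε) (hu : ‖u‖ = 1)
    (ho : ‖o‖ = 1) (huo : inner ℝ u o = 0) (hθ : 0 < θ) (hρ0 : 0 ≤ ρ) (hρ1 : ρ < 1)
    (hε : ε ≤ θ * (1 - ρ) / 4) (hε0 : 0 ≤ ε) (ht : t ≤ inner ℝ u (T u))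
    (hev : Module.End.HasEigenvalue T t) :
    Module.finrank ℝ (Module.End.eigenspace T t) = 1 := by
  obtain ⟨v, hv⟩ := hev.exists_hasEigenvector
  have huv : inner ℝ u v ≠ 0 := fun h0 => hv.2
    (h.eq_zero_of_inner_eq_zero hu ho huo hθ hρ0 hρ1 hε hε0 ht hv.apply_eq_smul h0)
  rw [finrank_eq_one_iff_of_nonzero' (⟨v, hv.1⟩ : Module.End.eigenspace T t)
    fun h0 => hv.2 (congrArg Subtype.val h0)]
  rintro ⟨x, hx⟩
  refine ⟨inner ℝ u x / inner ℝ u v, Subtype.ext ?_⟩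
  have hx' := Module.End.mem_eigenspace_iff.1 hx
  refine (sub_eq_zero.1 (h.eq_zero_of_inner_eq_zero hu ho huo hθ hρ0 hρ1 hε hε0 ht
    (x := x - (inner ℝ u x / inner ℝ u v) • v) ?_ ?_)).symm
  · rw [map_sub, map_smul, hx', hv.apply_eq_smul, smul_sub, smul_comm]
  · rw [inner_sub_right, real_inner_smul_right, div_mul_cancel₀ _ huv, sub_self]

lemma IsNearSpike.exists_sign (h : IsNearSpike T u o θ ρ ε) (hu : ‖u‖ = 1)
    (ho : ‖o‖ = 1) (huo : inner ℝ u o = 0) (hθ : 0 < θ) (hρ0 : 0 ≤ ρ) (hρ1 : ρ < 1)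
    (hε : ε ≤ θ * (1 - ρ) / 4) (hε0 : 0 ≤ ε) (ht : t ≤ inner ℝ u (T u)) {x : E}
    (hx : T x = t • x) (hxn : ‖x‖ = 1) :
    ∃ τ : ℝ, (τ = 1 ∨ τ = -1) ∧ ‖τ • x - u‖ ≤ 4 / (θ * (1 - ρ)) * ε := by
  have h1 := h.norm_orth_le hu ho huo hθ hρ0 hε hε0 ht hx
  set w := x - inner ℝ u x • u with hw
  have h2 : 0 < θ * (1 - ρ) := mul_pos hθ (by linarith)
  have hwn : ‖w‖ ^ 2 = 1 - inner ℝ u x ^ 2 := by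
    rw [hw, norm_sub_sq_real, norm_smul, hu, hxn, real_inner_smul_right, real_inner_comm,
      Real.norm_eq_abs, mul_one, sq_abs]
    ring
  have key : ∀ τ : ℝ, τ ^ 2 = 1 → 0 ≤ τ * inner ℝ u x →
      ‖τ • x - u‖ ≤ 4 / (θ * (1 - ρ)) * ε := by
    intro τ hτ hs
    have h3 : ‖τ • x - u‖ ^ 2 = 2 - 2 * (τ * inner ℝ u x) := by
      rw [norm_sub_sq_real, norm_smul, hu, hxn, real_inner_smul_left, real_inner_comm,
        Real.norm_eq_abs, mul_one, sq_abs, hτ]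
      ring
    have h4 : (τ * inner ℝ u x) ^ 2 = inner ℝ u x ^ 2 := by rw [mul_pow, hτ, one_mul]
    -- With `c = |⟨u, x⟩| ∈ [0, 1]` this is `2 - 2c ≤ 4(1 - c²)`; the sign `τ` is chosen so that `c
    -- ≥ 0` can be used.
    have h5 : ‖τ • x - u‖ ≤ 2 * ‖w‖ := by
      refine (sq_le_sq₀ (norm_nonneg _) (by positivity)).1 ?_
      rw [mul_pow, hwn, h3, ← h4]
      have h6 : (τ * inner ℝ u x) ^ 2 ≤ 1 := by
        rw [h4]; nlinarith [sq_nonneg ‖w‖]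
      nlinarith
    refine h5.trans ?_
    rw [hxn, mul_one] at h1
    rw [div_mul_eq_mul_div, le_div_iff₀ h2]
    linarith
  rcases le_total 0 (inner ℝ u x) with hs | hs
  · exact ⟨1, Or.inl rfl, key 1 (by norm_num) (by simpa using hs)⟩
  · exact ⟨-1, Or.inr rfl, key (-1) (by norm_num) (by linarith)⟩

end Perturbation

/-! ### The least eigenvalue -/

lemma hasEigenvalue_leastEigenvalue {n : ℕ} [NeZero n] {X : Matrix (Fin n) (Fin n) ℝ}
    (hX : X.IsHermitian) :
    Module.End.HasEigenvalue (Matrix.toEuclideanLin X) (leastEigenvalue X) := by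
  have hT := Matrix.isSymmetric_toEuclideanLin_iff.2 hX
  have hne : {t : ℝ | Module.End.HasEigenvalue (Matrix.toEuclideanLin X) t}.Nonempty :=
    ⟨_, hT.hasEigenvalue_iInf_of_finiteDimensional⟩
  exact hne.csInf_mem (Module.End.finite_hasEigenvalue _)

/-- The infimum of the Rayleigh quotient is itself an eigenvalue in finite dimension. -/
lemma leastEigenvalue_le_inner {n : ℕ} [NeZero n] {X : Matrix (Fin n) (Fin n) ℝ}
    (hX : X.IsHermitian) {u : EuclideanSpace ℝ (Fin n)} (hu : ‖u‖ = 1) :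
    leastEigenvalue X ≤ inner ℝ u (Matrix.toEuclideanLin X u) := by
  have hT := Matrix.isSymmetric_toEuclideanLin_iff.2 hX
  have h1 : leastEigenvalue X ≤ _ := csInf_le
    (Module.End.finite_hasEigenvalue (Matrix.toEuclideanLin X)).bddBelow
    hT.hasEigenvalue_iInf_of_finiteDimensional
  refine h1.trans ?_
  have hu0 : u ≠ 0 := by rintro rfl; simp at hu
  refine (ciInf_le ?_ (⟨u, hu0⟩ : {x : EuclideanSpace ℝ (Fin n) // x ≠ 0})).trans (le_of_eq ?_)
  · refine ⟨-‖(Matrix.toEuclideanLin X).toContinuousLinearMap‖, ?_⟩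
    rintro _ ⟨x, rfl⟩
    exact (abs_le.1 ((Matrix.toEuclideanLin X).toContinuousLinearMap.rayleighQuotient_le_norm
      x.1)).1
  · simp [hu, real_inner_comm]

/-- The spectral conclusions for a matrix that is near a spiked matrix. -/
lemma spectral_of_isNearSpike {n : ℕ} [NeZero n] {X : Matrix (Fin n) (Fin n) ℝ}
    (hX : X.IsHermitian) {u o : EuclideanSpace ℝ (Fin n)} {θ ρ ε : ℝ}
    (h : IsNearSpike (Matrix.toEuclideanLin X) u o θ ρ ε) (hu : ‖u‖ = 1)
    (ho : ‖o‖ = 1) (huo : inner ℝ u o = 0) (hθ : 0 < θ) (hρ0 : 0 ≤ ρ) (hρ1 : ρ < 1)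
    (hε : ε ≤ θ * (1 - ρ) / 4) (hε0 : 0 ≤ ε) :
    IsSimpleEigenvalue X (leastEigenvalue X) ∧
      (∀ x y, IsUnitEigenvector X (leastEigenvalue X) x →
        IsUnitEigenvector X (leastEigenvalue X) y → y = x ∨ y = -x) ∧
      ∀ x, IsUnitEigenvector X (leastEigenvalue X) x →
        ∃ τ : ℝ, (τ = 1 ∨ τ = -1) ∧ ‖τ • x - u‖ ≤ 4 / (θ * (1 - ρ)) * ε := by
  have ht := leastEigenvalue_le_inner hX hu
  have hr := h.finrank_eigenspace hu ho huo hθ hρ0 hρ1 hε hε0 ht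
    (hasEigenvalue_leastEigenvalue hX)
  refine ⟨hr, fun x y hx hy => ?_, fun x hx =>
    h.exists_sign hu ho huo hθ hρ0 hρ1 hε hε0 ht hx.1.apply_eq_smul hx.2⟩
  obtain ⟨c, hc⟩ := (finrank_eq_one_iff_of_nonzero'
    (⟨x, hx.1.1⟩ : Module.End.eigenspace (Matrix.toEuclideanLin X) (leastEigenvalue X))
    fun h0 => hx.1.2 (congrArg Subtype.val h0)).1 hr ⟨y, hy.1.1⟩
  have hc' : c • x = y := congrArg Subtype.val hc
  have hn : |c| = 1 := by
    have := hy.2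
    rwa [← hc', norm_smul, hx.2, mul_one, Real.norm_eq_abs] at this
  rcases (abs_eq zero_le_one).1 hn with h1 | h1
  · left; rw [← hc', h1, one_smul]
  · right; rw [← hc', h1, neg_one_smul]

/-! ### Normalized Laplacians of perturbed block matrices -/

section Normalized

variable {n : ℕ}

lemma inner_eq_sum (x y : EuclideanSpace ℝ (Fin n)) : inner ℝ x y = ∑ i, x i * y i := by
  simp [PiLp.inner_apply, mul_comm]

lemma inner_toEuclideanLin_eq_sum (M : Matrix (Fin n) (Fin n) ℝ)
    (x y : EuclideanSpace ℝ (Fin n)) :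
    inner ℝ x (Matrix.toEuclideanLin M y) = ∑ i, ∑ j, x i * M i j * y j := by
  rw [inner_eq_sum]
  simp [Matrix.mulVec, dotProduct, Finset.mul_sum, mul_assoc]

lemma abs_inner_toEuclideanLin_le (M : Matrix (Fin n) (Fin n) ℝ)
    (x y : EuclideanSpace ℝ (Fin n)) :
    |inner ℝ x (Matrix.toEuclideanLin M y)| ≤ ‖M‖ * (‖x‖ * ‖y‖) := by
  calc _ ≤ ‖x‖ * ‖Matrix.toEuclideanLin M y‖ := abs_real_inner_le_norm _ _
    _ ≤ ‖x‖ * (‖M‖ * ‖y‖) := by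
        gcongr
        exact (Matrix.toEuclideanCLM (𝕜 := ℝ) M).le_opNorm y
    _ = _ := by ring

/-- The vector `D^{-1/2} x`. -/
def scaleVec (A : Matrix (Fin n) (Fin n) ℝ) (x : EuclideanSpace ℝ (Fin n)) :
    EuclideanSpace ℝ (Fin n) :=
  WithLp.toLp 2 fun i => (√(degree A i))⁻¹ * x i

lemma norm_scaleVec_le (A : Matrix (Fin n) (Fin n) ℝ) {M : ℝ} (hM0 : 0 ≤ M)
    (hd : ∀ i, 0 < degree A i) (hM : ∀ i, (degree A i)⁻¹ ≤ M) (x : EuclideanSpace ℝ (Fin n)) :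
    ‖scaleVec A x‖ ≤ √M * ‖x‖ := by
  refine (sq_le_sq₀ (norm_nonneg _) (by positivity)).1 ?_
  rw [mul_pow, Real.sq_sqrt hM0, EuclideanSpace.norm_sq_eq, EuclideanSpace.norm_sq_eq,
    Finset.mul_sum]
  refine Finset.sum_le_sum fun i _ => ?_
  simp only [scaleVec, Real.norm_eq_abs, sq_abs, mul_pow, inv_pow, Real.sq_sqrt (hd i).le]
  gcongr
  exact hM i

lemma normalizedLaplacian_isHermitian {A : Matrix (Fin n) (Fin n) ℝ}
    (hA : ∀ i j, A i j = A j i) : (normalizedLaplacian A).IsHermitian := by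
  refine Matrix.IsHermitian.ext fun i j => ?_
  simp only [normalizedLaplacian, invSqrtDegree, signedLaplacian, Matrix.mul_diagonal,
    Matrix.diagonal_mul, Matrix.sub_apply, star_trivial, hA j i, Matrix.diagonal_apply]
  by_cases h : i = j
  · subst h; rfl
  · rw [if_neg h, if_neg (Ne.symm h)]; ring

lemma inner_normalizedLaplacian {A : Matrix (Fin n) (Fin n) ℝ} (hd : ∀ i, 0 < degree A i)
    (x y : EuclideanSpace ℝ (Fin n)) :
    inner ℝ x (Matrix.toEuclideanLin (normalizedLaplacian A) y) =
      inner ℝ x y - inner ℝ (scaleVec A x) (Matrix.toEuclideanLin A (scaleVec A y)) := by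
  rw [inner_toEuclideanLin_eq_sum, inner_toEuclideanLin_eq_sum, inner_eq_sum,
    ← Finset.sum_sub_distrib]
  refine Finset.sum_congr rfl fun i _ => ?_
  have hs : (√(degree A i))⁻¹ * degree A i * (√(degree A i))⁻¹ = 1 := by
    have h := Real.sqrt_pos.2 (hd i)
    conv_lhs => rw [← Real.sq_sqrt (hd i).le]
    rw [Real.sqrt_sq (Real.sqrt_nonneg _)]
    field_simp
  have h1 : x i * y i = ∑ j, if i = j then x i * y j else 0 := by simp
  rw [h1, ← Finset.sum_sub_distrib]
  refine Finset.sum_congr rfl fun j _ => ?_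
  simp only [normalizedLaplacian, invSqrtDegree, signedLaplacian, Matrix.mul_diagonal,
    Matrix.diagonal_mul, Matrix.sub_apply, Matrix.diagonal_apply, scaleVec]
  by_cases h : i = j
  · subst h
    simp only [if_true]
    linear_combination (x i * y i) * hs
  · simp only [h, if_false]
    ring

/-- Since `v` is flat, Cauchy–Schwarz needs only the average of `(b / √dᵢ - 1)²`, so a few atypical
degrees do no harm. -/
lemma abs_inner_scaleVec_sub_le {A : Matrix (Fin n) (Fin n) ℝ}
    {v : EuclideanSpace ℝ (Fin n)} {b η : ℝ} (hv : ∀ i, v i ^ 2 = (n : ℝ)⁻¹)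
    (hη0 : 0 ≤ η) (hη : (n : ℝ)⁻¹ * ∑ i, (b * (√(degree A i))⁻¹ - 1) ^ 2 ≤ η ^ 2)
    (x : EuclideanSpace ℝ (Fin n)) :
    |b * inner ℝ v (scaleVec A x) - inner ℝ v x| ≤ η * ‖x‖ := by
  have h1 : b * inner ℝ v (scaleVec A x) - inner ℝ v x =
      ∑ i, (v i * (b * (√(degree A i))⁻¹ - 1)) * x i := by
    rw [inner_eq_sum, inner_eq_sum, Finset.mul_sum, ← Finset.sum_sub_distrib]
    refine Finset.sum_congr rfl fun i _ => ?_
    simp only [scaleVec]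
    ring
  refine abs_le_of_sq_le_sq ?_ (by positivity)
  rw [h1, mul_pow, EuclideanSpace.norm_sq_eq]
  refine (Finset.sum_mul_sq_le_sq_mul_sq _ _ _).trans ?_
  simp only [mul_pow, hv, ← Finset.mul_sum, Real.norm_eq_abs, sq_abs]
  gcongr

lemma abs_mul_sub_mul_le {a b c d η X Y : ℝ} (hη : 0 ≤ η) (hX : 0 ≤ X)
    (h1 : |a - c| ≤ η * X) (h2 : |b - d| ≤ η * Y) (hc : |c| ≤ X) (hd : |d| ≤ Y) :
    |a * b - c * d| ≤ (2 * η + η ^ 2) * X * Y := by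
  have e : a * b - c * d = (a - c) * (b - d) + (a - c) * d + c * (b - d) := by ring
  rw [e]
  refine (abs_add_three _ _ _).trans ?_
  rw [abs_mul, abs_mul, abs_mul]
  calc _ ≤ (η * X) * (η * Y) + (η * X) * Y + X * (η * Y) := by gcongr
    _ = _ := by ring

lemma inner_toEuclideanLin_block {A W : Matrix (Fin n) (Fin n) ℝ}
    {u o : EuclideanSpace ℝ (Fin n)} {θ δ ρ p : ℝ}
    (hA : ∀ i j, A i j = 2 * W i j + θ * (δ * (u i * u j) + ρ * δ * (o i * o j)) -
      if i = j then θ * p else 0) (x y : EuclideanSpace ℝ (Fin n)) :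
    inner ℝ x (Matrix.toEuclideanLin A y) =
      2 * inner ℝ x (Matrix.toEuclideanLin W y) + θ * (δ * (inner ℝ u x * inner ℝ u y) +
        ρ * δ * (inner ℝ o x * inner ℝ o y)) - θ * p * inner ℝ x y := by
  have h1 : ∀ v : EuclideanSpace ℝ (Fin n), inner ℝ v x * inner ℝ v y =
      ∑ i, ∑ j, x i * (v i * v j) * y j := fun v => by
    rw [inner_eq_sum, inner_eq_sum, Finset.sum_mul_sum]
    exact Finset.sum_congr rfl fun i _ => Finset.sum_congr rfl fun j _ => by ring
  have h2 : inner ℝ x y = ∑ i, ∑ j, x i * (if i = j then 1 else 0) * y j := by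
    rw [inner_eq_sum]; simp
  rw [inner_toEuclideanLin_eq_sum, inner_toEuclideanLin_eq_sum, h1, h1, h2]
  simp only [Finset.mul_sum, ← Finset.sum_add_distrib, ← Finset.sum_sub_distrib]
  refine Finset.sum_congr rfl fun i _ => Finset.sum_congr rfl fun j _ => ?_
  rw [hA]
  split_ifs <;> ring

/-- The three error terms come from the noise `2W`, from replacing `√δ D^{-1/2}` by the identity in
the two spikes, and from the diagonal correction `θp`. -/
lemma isNearSpike_normalizedLaplacian {A W : Matrix (Fin n) (Fin n) ℝ}
    {u o : EuclideanSpace ℝ (Fin n)} {θ δ ρ p T M η : ℝ}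
    (hA : ∀ i j, A i j = 2 * W i j + θ * (δ * (u i * u j) + ρ * δ * (o i * o j)) -
      if i = j then θ * p else 0)
    (hd : ∀ i, 0 < degree A i) (hM0 : 0 ≤ M) (hM : ∀ i, (degree A i)⁻¹ ≤ M) (hW : ‖W‖ ≤ T)
    (hu : ‖u‖ = 1) (ho : ‖o‖ = 1) (hun : ∀ i, u i ^ 2 = (n : ℝ)⁻¹)
    (hon : ∀ i, o i ^ 2 = (n : ℝ)⁻¹) (hη0 : 0 ≤ η) (hδ : 0 ≤ δ)
    (hη : (n : ℝ)⁻¹ * ∑ i, (√δ * (√(degree A i))⁻¹ - 1) ^ 2 ≤ η ^ 2)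
    (hθ0 : 0 ≤ θ) (hθ1 : θ ≤ 1) (hρ0 : 0 ≤ ρ) (hρ1 : ρ ≤ 1) (hp : 0 ≤ p) :
    IsNearSpike (Matrix.toEuclideanLin (normalizedLaplacian A)) u o θ ρ
      (2 * T * M + 2 * (2 * η + η ^ 2) + p * M) := by
  intro x y
  have hx := norm_scaleVec_le A hM0 hd hM x
  have hy := norm_scaleVec_le A hM0 hd hM y
  have hxy : ‖scaleVec A x‖ * ‖scaleVec A y‖ ≤ M * (‖x‖ * ‖y‖) := by
    calc _ ≤ (√M * ‖x‖) * (√M * ‖y‖) := by gcongr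
      _ = (√M * √M) * (‖x‖ * ‖y‖) := by ring
      _ = _ := by rw [Real.mul_self_sqrt hM0]
  have hT0 : 0 ≤ T := (norm_nonneg _).trans hW
  have b1 : |2 * inner ℝ (scaleVec A x) (Matrix.toEuclideanLin W (scaleVec A y))| ≤
      2 * T * M * (‖x‖ * ‖y‖) := by
    rw [abs_mul, abs_two]
    calc _ ≤ 2 * (‖W‖ * (‖scaleVec A x‖ * ‖scaleVec A y‖)) := by
          gcongr; exact abs_inner_toEuclideanLin_le _ _ _
      _ ≤ 2 * (T * (M * (‖x‖ * ‖y‖))) := by gcongr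
      _ = _ := by ring
  have b2 : |θ * p * inner ℝ (scaleVec A x) (scaleVec A y)| ≤ p * M * (‖x‖ * ‖y‖) := by
    rw [abs_mul, abs_of_nonneg (by positivity)]
    calc _ ≤ 1 * p * (‖scaleVec A x‖ * ‖scaleVec A y‖) := by
          gcongr; exact abs_real_inner_le_norm _ _
      _ ≤ 1 * p * (M * (‖x‖ * ‖y‖)) := by gcongr
      _ = _ := by ring
  have b3 : ∀ v : EuclideanSpace ℝ (Fin n), ‖v‖ = 1 → (∀ i, v i ^ 2 = (n : ℝ)⁻¹) →
      |δ * (inner ℝ v (scaleVec A x) * inner ℝ v (scaleVec A y)) - inner ℝ v x * inner ℝ v y| ≤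
        (2 * η + η ^ 2) * ‖x‖ * ‖y‖ := by
    intro v hv hvn
    have hb : ∀ z : EuclideanSpace ℝ (Fin n), |inner ℝ v z| ≤ ‖z‖ := fun z => by
      simpa [hv] using abs_real_inner_le_norm v z
    have h := abs_mul_sub_mul_le hη0 (norm_nonneg x)
      (abs_inner_scaleVec_sub_le hvn hη0 hη x) (abs_inner_scaleVec_sub_le hvn hη0 hη y)
      (hb x) (hb y)
    refine le_trans (le_of_eq ?_) h
    congr 1
    nth_rewrite 1 [← Real.mul_self_sqrt hδ]
    ring
  have hu' := b3 u hu hun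
  have ho' := b3 o ho hon
  rw [inner_normalizedLaplacian hd, inner_toEuclideanLin_block hA]
  set F := inner ℝ (scaleVec A x) (Matrix.toEuclideanLin W (scaleVec A y))
  set a := δ * (inner ℝ u (scaleVec A x) * inner ℝ u (scaleVec A y)) - inner ℝ u x * inner ℝ u y
    with ha
  set b := δ * (inner ℝ o (scaleVec A x) * inner ℝ o (scaleVec A y)) - inner ℝ o x * inner ℝ o y
    with hb
  have hab : |θ * (a + ρ * b)| ≤ 2 * ((2 * η + η ^ 2) * ‖x‖ * ‖y‖) := by
    rw [abs_mul, abs_of_nonneg hθ0]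
    calc _ ≤ 1 * (|a| + |ρ * b|) := by gcongr; exact abs_add_le _ _
      _ = |a| + ρ * |b| := by rw [one_mul, abs_mul, abs_of_nonneg hρ0]
      _ ≤ (2 * η + η ^ 2) * ‖x‖ * ‖y‖ + 1 * ((2 * η + η ^ 2) * ‖x‖ * ‖y‖) := by gcongr
      _ = _ := by ring
  calc _ = |2 * F + θ * (a + ρ * b) + -(θ * p * inner ℝ (scaleVec A x) (scaleVec A y))| := by
        congr 1; rw [ha, hb]; ring
    _ ≤ |2 * F| + |θ * (a + ρ * b)| + |-(θ * p * inner ℝ (scaleVec A x) (scaleVec A y))| :=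
        abs_add_three _ _ _
    _ ≤ 2 * T * M * (‖x‖ * ‖y‖) + 2 * ((2 * η + η ^ 2) * ‖x‖ * ‖y‖) +
        p * M * (‖x‖ * ‖y‖) := by
        rw [abs_neg]; gcongr
    _ = _ := by ring

/-- The degrees concentrate in mean square. -/
lemma sum_sq_degree_sub_le {A W : Matrix (Fin n) (Fin n) ℝ} {δ p T : ℝ}
    (hd : ∀ i, degree A i = 2 * ∑ j, W i j + δ - p) (hW : ‖W‖ ≤ T) :
    ∑ i, (degree A i - δ) ^ 2 ≤ n * (8 * T ^ 2 + 2 * p ^ 2) := by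
  -- The row sums of `W` are its image of the all-ones vector, whose square norm is `n`.
  have h1 := (Matrix.toEuclideanCLM (𝕜 := ℝ) W).le_opNorm (WithLp.toLp 2 fun _ => 1)
  rw [← Matrix.cstar_norm_def] at h1
  have h2 := pow_le_pow_left₀ (norm_nonneg _) h1 2
  rw [mul_pow, EuclideanSpace.norm_sq_eq, EuclideanSpace.norm_sq_eq] at h2
  simp only [Matrix.ofLp_toEuclideanCLM, Matrix.mulVec, dotProduct, mul_one, Real.norm_eq_abs,
    sq_abs, one_pow, Finset.sum_const, Finset.card_univ, Fintype.card_fin, nsmul_eq_mul] at h2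
  calc _ ≤ ∑ i, (8 * (∑ j, W i j) ^ 2 + 2 * p ^ 2) := by
        refine Finset.sum_le_sum fun i _ => ?_
        rw [hd]
        nlinarith [sq_nonneg (2 * ∑ j, W i j + p)]
    _ = 8 * ∑ i, (∑ j, W i j) ^ 2 + n * (2 * p ^ 2) := by
        rw [Finset.sum_add_distrib, ← Finset.mul_sum]; simp
    _ ≤ 8 * (T ^ 2 * n) + n * (2 * p ^ 2) := by
        gcongr
        exact h2.trans (by gcongr)
    _ = _ := by ring

/-- Termwise, `(√δ/√d - 1)² = (√δ - √d)²/d ≤ (d - δ)²/(dδ)`, because `(√d + √δ)² ≥ δ`. -/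
lemma sum_sqrt_ratio_le {A : Matrix (Fin n) (Fin n) ℝ} {δ M S : ℝ} (hn : 0 < n)
    (hδ : 0 < δ) (hd : ∀ i, 0 < degree A i) (hM : ∀ i, (degree A i)⁻¹ ≤ M)
    (hS : ∑ i, (degree A i - δ) ^ 2 ≤ n * S) :
    (n : ℝ)⁻¹ * ∑ i, (√δ * (√(degree A i))⁻¹ - 1) ^ 2 ≤ S * M / δ := by
  have hn' : (0 : ℝ) < n := by exact_mod_cast hn
  have hM0 : 0 ≤ M := (inv_pos.2 (hd ⟨0, hn⟩)).le.trans (hM _)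
  calc _ ≤ (n : ℝ)⁻¹ * ∑ i, (degree A i - δ) ^ 2 * (M / δ) := by
        gcongr with i _
        have hdi := hd i
        set a := √(degree A i) with ha
        set b := √δ with hb
        have ha0 : 0 < a := Real.sqrt_pos.2 hdi
        have hb0 : 0 < b := Real.sqrt_pos.2 hδ
        have ha2 : degree A i = a ^ 2 := (Real.sq_sqrt hdi.le).symm
        have hb2 : δ = b ^ 2 := (Real.sq_sqrt hδ.le).symm
        have h1 : (degree A i - δ) ^ 2 * ((degree A i)⁻¹ / δ) ≤
            (degree A i - δ) ^ 2 * (M / δ) := by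
          gcongr; exact hM i
        refine le_trans ?_ h1
        rw [ha2, hb2]
        have e1 : (b * a⁻¹ - 1) ^ 2 = (b - a) ^ 2 * b ^ 2 / (a ^ 2 * b ^ 2) := by field_simp
        have e2 : (a ^ 2 - b ^ 2) ^ 2 * ((a ^ 2)⁻¹ / b ^ 2) =
            (b - a) ^ 2 * (a + b) ^ 2 / (a ^ 2 * b ^ 2) := by field_simp; ring
        rw [e1, e2]
        gcongr
        linarith
    _ = (n : ℝ)⁻¹ * (∑ i, (degree A i - δ) ^ 2) * (M / δ) := by
        rw [← Finset.sum_mul, mul_assoc]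
    _ ≤ (n : ℝ)⁻¹ * (n * S) * (M / δ) := by gcongr
    _ = _ := by field_simp

end Normalized

/-! ### The law of a single pair -/

/-- The law of the edge bit and the sign bit of a pair. -/
abbrev bitLaw (P S : I) : Measure (Bool × Bool) :=
  (bernoulliMeasure true false P).prod (bernoulliMeasure true false S)

lemma integral_bitLaw (P S : I) (h : Bool × Bool → ℝ) :
    ∫ b, h b ∂bitLaw P S = P * (S * h (true, true) + (1 - S) * h (true, false)) +
      (1 - P) * (S * h (false, true) + (1 - S) * h (false, false)) := by
  rw [integral_prod _ Integrable.of_finite, integral_bernoulli_bool, integral_bernoulli_bool,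
    integral_bernoulli_bool]

lemma integral_signedEntry (P S : I) :
    ∫ b, signedEntry b ∂bitLaw P S = P * (1 - 2 * S) := by
  rw [integral_bitLaw]
  simp only [signedEntry, if_true, Bool.false_eq_true, if_false]
  ring

lemma integral_abs_signedEntry (P S : I) : ∫ b, |signedEntry b| ∂bitLaw P S = P := by
  rw [integral_bitLaw]
  simp only [signedEntry, if_true, Bool.false_eq_true, if_false]
  norm_num

/-- Half the deviation of a variable from its mean. -/
def halfDev (P S : I) (g : Bool × Bool → ℝ) (b : Bool × Bool) : ℝ :=
  (g b - ∫ c, g c ∂bitLaw P S) / 2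

lemma integral_halfDev (P S : I) (g : Bool × Bool → ℝ) :
    ∫ b, halfDev P S g b ∂bitLaw P S = 0 := by
  simp only [halfDev]
  rw [integral_div, integral_sub Integrable.of_finite Integrable.of_finite]
  simp

/-- Halving the deviation keeps it in `[-1, 1]`, so its higher moments are dominated by the second
one. -/
lemma abs_halfDev_le (P S : I) {g : Bool × Bool → ℝ} (hg : ∀ b, |g b| ≤ 1) (b : Bool × Bool) :
    |halfDev P S g b| ≤ 1 := by
  have h1 : |∫ c, g c ∂bitLaw P S| ≤ 1 := by
    refine abs_integral_le_integral_abs.trans ?_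
    calc _ ≤ ∫ _c, (1 : ℝ) ∂bitLaw P S :=
          integral_mono Integrable.of_finite Integrable.of_finite hg
      _ = 1 := by simp
  have h2 := abs_sub (g b) (∫ c, g c ∂bitLaw P S)
  rw [halfDev, abs_div, abs_two]
  linarith [hg b]

lemma integral_halfDev_sq_le (P S : I) {g : Bool × Bool → ℝ} (hg : ∀ b, |g b| ≤ 1)
    (hg0 : ∀ c, g (false, c) = 0) : ∫ b, halfDev P S g b ^ 2 ∂bitLaw P S ≤ P := by
  set m := ∫ c, g c ∂bitLaw P S with hm
  have h1 : ∫ b, halfDev P S g b ^ 2 ∂bitLaw P S =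
      (∫ b, g b ^ 2 ∂bitLaw P S - m ^ 2) / 4 := by
    have hm' := hm
    rw [integral_bitLaw] at hm'
    simp only [halfDev, ← hm]
    rw [integral_bitLaw, integral_bitLaw]
    linear_combination (m / 2) * hm'
  have h2 : ∫ b, g b ^ 2 ∂bitLaw P S ≤ P := by
    rw [← integral_abs_signedEntry P S]
    refine integral_mono Integrable.of_finite Integrable.of_finite fun b => ?_
    rcases b with ⟨b, c⟩
    cases b
    · simp [hg0]
    · have := pow_le_one₀ (abs_nonneg _) (hg (true, c)) (n := 2)
      rw [sq_abs] at this
      cases c <;> norm_num [signedEntry] <;> simpa using this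
  have hP := P.2.1
  rw [h1]
  nlinarith [sq_nonneg m]

lemma abs_signedEntry_le (b : Bool × Bool) : |signedEntry b| ≤ 1 := by
  rcases b with ⟨b, c⟩
  cases b <;> cases c <;> norm_num [signedEntry]

/-! ### A lower bound on the degrees -/

lemma integral_exp_abs_signedEntry_le (P S : I) :
    ∫ b, Real.exp (-2 * |signedEntry b|) ∂bitLaw P S ≤ Real.exp (-0.85 * P) := by
  have h1 : ∫ b, Real.exp (-2 * |signedEntry b|) ∂bitLaw P S =
      1 - P * (1 - Real.exp (-2)) := by
    rw [integral_bitLaw]; norm_num [signedEntry]; ring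
  have h2 : Real.exp (-2) ≤ 0.15 := by
    rw [Real.exp_neg, inv_le_comm₀ (Real.exp_pos _) (by norm_num),
      show (2 : ℝ) = (2 : ℕ) * 1 by norm_num, Real.exp_nat_mul]
    have := Real.exp_one_gt_d9
    nlinarith
  have hP := P.2.1
  have h3 := Real.add_one_le_exp (-0.85 * (P : ℝ))
  rw [h1]
  nlinarith

lemma prod_integral_fiber {ι κ α : Type*} [Fintype ι] [Fintype κ] [DecidableEq κ]
    [MeasurableSpace α] (μ : κ → Measure α) [∀ c, IsProbabilityMeasure (μ c)]
    (F : α → ℝ) {e : ι → κ} (he : Function.Injective e) :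
    ∫ ω, ∏ i, F (ω (e i)) ∂Measure.pi μ = ∏ i, ∫ x, F x ∂μ (e i) := by
  rw [integral_prod_comp μ (fun _ => F) e,
    ← Finset.prod_fiberwise (s := Finset.univ) (g := e) (f := fun i => ∫ x, F x ∂μ (e i))]
  refine Finset.prod_congr rfl fun c _ => ?_
  by_cases hc : ∃ i, e i = c
  · obtain ⟨i, rfl⟩ := hc
    have : (Finset.univ.filter fun j => e j = e i) = {i} := by
      ext j; simp [he.eq_iff]
    simp [this]
  · have : (Finset.univ.filter fun j => e j = c) = ∅ :=
      Finset.filter_eq_empty_iff.2 fun i _ h => hc ⟨i, h⟩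
    simp [this]

lemma degree_signedAdjacency {n : ℕ} (ω : NodePair n → Bool × Bool) (i : Fin n) :
    degree (signedAdjacency ω) i =
      ∑ j : {j // j ≠ i}, |signedEntry (ω (pairOf i j j.2.symm))| := by
  rw [degree, ← Finset.sum_erase Finset.univ (a := i)
    (by rw [signedAdjacency_eq, symMatrix_self, abs_zero]),
    Finset.sum_subtype (Finset.univ.erase i) (p := fun j => j ≠ i) (by simp)]
  refine Finset.sum_congr rfl fun j _ => ?_
  rw [signedAdjacency_eq, symMatrix_of_ne _ j.2.symm]

/-- The `n - 1` pairs at a node are distinct, hence independent, and each contributes `1 - P(1 -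
e⁻²) ≤ exp(-0.85 P)`. -/
lemma integral_exp_degree_le {n : ℕ} (P S : NodePair n → I) {q : ℝ} (hq : ∀ e, q ≤ P e)
    (i : Fin n) :
    ∫ ω, Real.exp (-2 * degree (signedAdjacency ω) i)
        ∂(Measure.pi fun e => bitLaw (P e) (S e)) ≤
      Real.exp (-0.85 * ((n - 1) * q)) := by
  have hinj : Function.Injective fun j : {j // j ≠ i} => pairOf i j j.2.symm := by
    intro j j' h
    rcases (pairOf_eq_iff _ _).1 h with h | h
    · exact Subtype.ext h.2
    · exact absurd h.2 j.2
  have hn : 1 ≤ n := i.pos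
  simp only [degree_signedAdjacency, Finset.mul_sum, Real.exp_sum]
  rw [prod_integral_fiber (fun e => bitLaw (P e) (S e))
    (fun b => Real.exp (-2 * |signedEntry b|)) hinj]
  calc _ ≤ ∏ _j : {j // j ≠ i}, Real.exp (-0.85 * q) := by
        refine Finset.prod_le_prod (fun _ _ => integral_nonneg fun _ => (Real.exp_pos _).le)
          fun j _ => (integral_exp_abs_signedEntry_le _ _).trans (Real.exp_le_exp.2 ?_)
        have := hq (pairOf i j j.2.symm)
        linarith
    _ = Real.exp (-0.85 * ((n - 1) * q)) := by
        rw [Finset.prod_const, ← Real.exp_nat_mul]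
        simp only [Finset.card_univ, Fintype.card_subtype_compl, Fintype.card_fin,
          Fintype.card_subtype_eq]
        rw [Nat.cast_sub hn]
        push_cast
        ring_nf

lemma measure_degree_le {n : ℕ} (P S : NodePair n → I) {q : ℝ} (hq : ∀ e, q ≤ P e)
    (t : ℝ) :
    (Measure.pi fun e => bitLaw (P e) (S e)).real
        {ω | ∃ i, degree (signedAdjacency ω) i ≤ t} ≤
      n * Real.exp (2 * t - 0.85 * ((n - 1) * q)) := by
  have h1 : ∀ i : Fin n, (Measure.pi fun e => bitLaw (P e) (S e)).real
      {ω | degree (signedAdjacency ω) i ≤ t} ≤ Real.exp (2 * t - 0.85 * ((n - 1) * q)) := by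
    intro i
    have h2 := mul_meas_ge_le_integral_of_nonneg
      (μ := Measure.pi fun e => bitLaw (P e) (S e))
      (f := fun ω => Real.exp (-2 * degree (signedAdjacency ω) i))
      (.of_forall fun _ => (Real.exp_pos _).le) Integrable.of_finite (Real.exp (-2 * t))
    have h3 : {ω : NodePair n → Bool × Bool | Real.exp (-2 * t) ≤
        Real.exp (-2 * degree (signedAdjacency ω) i)} =
        {ω | degree (signedAdjacency ω) i ≤ t} := by
      ext ω
      simp only [Set.mem_ofPred_eq, Real.exp_le_exp]
      constructor <;> intro h <;> linarith
    rw [h3] at h2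
    have h4 := h2.trans (integral_exp_degree_le P S hq i)
    have h5 : Real.exp (2 * t - 0.85 * ((n - 1) * q)) =
        Real.exp (2 * t) * Real.exp (-0.85 * ((n - 1) * q)) := by
      rw [← Real.exp_add]; congr 1; ring
    rw [h5]
    refine le_trans (le_of_eq ?_) (mul_le_mul_of_nonneg_left h4 (Real.exp_pos (2 * t)).le)
    rw [← mul_assoc, ← Real.exp_add]
    simp
  have h2 : {ω : NodePair n → Bool × Bool | ∃ i, degree (signedAdjacency ω) i ≤ t} =
      ⋃ i, {ω | degree (signedAdjacency ω) i ≤ t} := by ext; simp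
  rw [h2]
  refine (measureReal_iUnion_fintype_le _).trans ((Finset.sum_le_sum fun i _ => h1 i).trans ?_)
  simp

/-! ### The bisection model -/

/-- The sign of the community of a node. -/
def nodeSign (k : ℕ) (i : Fin (2 * k)) : ℝ := if (i : ℕ) < k then 1 else -1

lemma nodeSign_mul_self (k : ℕ) (i : Fin (2 * k)) : nodeSign k i * nodeSign k i = 1 := by
  unfold nodeSign; split_ifs <;> norm_num

lemma sum_nodeSign (k : ℕ) : ∑ i, nodeSign k i = 0 := by
  have h : ∑ i, nodeSign k i = ∑ i ∈ Finset.range (2 * k), (if i < k then 1 else -1 : ℝ) :=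
    (Finset.sum_range fun i => (if i < k then 1 else -1 : ℝ)).symm
  rw [h, two_mul, Finset.sum_range_add,
    Finset.sum_congr rfl fun i hi => if_pos (Finset.mem_range.1 hi),
    Finset.sum_congr rfl fun i _ => if_neg (by omega : ¬ k + i < k)]
  simp

/-- The normalized all-ones vector. -/
def onesVector (k : ℕ) : EuclideanSpace ℝ (Fin (2 * k)) :=
  WithLp.toLp 2 fun _ => 1 / √(2 * (k : ℝ))

lemma meanEigenvector_apply (k : ℕ) (i : Fin (2 * k)) :
    meanEigenvector k i = nodeSign k i / √(2 * (k : ℝ)) := rfl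

lemma onesVector_apply (k : ℕ) (i : Fin (2 * k)) : onesVector k i = 1 / √(2 * (k : ℝ)) := rfl

lemma meanEigenvector_mul (k : ℕ) (i j : Fin (2 * k)) :
    meanEigenvector k i * meanEigenvector k j = nodeSign k i * nodeSign k j / (2 * k) := by
  rw [meanEigenvector_apply, meanEigenvector_apply, div_mul_div_comm,
    Real.mul_self_sqrt (by positivity)]

lemma onesVector_mul (k : ℕ) (i j : Fin (2 * k)) :
    onesVector k i * onesVector k j = 1 / (2 * k) := by
  rw [onesVector_apply, onesVector_apply, div_mul_div_comm,
    Real.mul_self_sqrt (by positivity), one_mul]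

lemma norm_eq_one_of_sq {n : ℕ} (hn : 0 < n) {v : EuclideanSpace ℝ (Fin n)}
    (hv : ∀ i, v i ^ 2 = (n : ℝ)⁻¹) : ‖v‖ = 1 := by
  have hn' : (n : ℝ) ≠ 0 := by exact_mod_cast hn.ne'
  have : ‖v‖ ^ 2 = 1 := by
    rw [EuclideanSpace.norm_sq_eq]
    simp [hv, hn']
  exact (pow_eq_one_iff_of_nonneg (norm_nonneg v) two_ne_zero).1 this

lemma meanEigenvector_sq (k : ℕ) (i : Fin (2 * k)) :
    meanEigenvector k i ^ 2 = ((2 * k : ℕ) : ℝ)⁻¹ := by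
  rw [sq, meanEigenvector_mul, nodeSign_mul_self]; push_cast; rw [one_div]

lemma onesVector_sq (k : ℕ) (i : Fin (2 * k)) :
    onesVector k i ^ 2 = ((2 * k : ℕ) : ℝ)⁻¹ := by
  rw [sq, onesVector_mul]; push_cast; rw [one_div]

lemma inner_meanEigenvector_onesVector (k : ℕ) :
    inner ℝ (meanEigenvector k) (onesVector k) = 0 := by
  rw [inner_eq_sum]
  simp only [meanEigenvector_apply, onesVector_apply]
  rw [← Finset.sum_mul, ← Finset.sum_div, sum_nodeSign]
  simp

/-- The edge probability of a pair. -/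
def edgeProb (k : ℕ) (p q : I) (e : NodePair (2 * k)) : I :=
  blockExtend (community k) !![p, q; q, p] e.1.1 e.1.2

/-- The probability that the sign of a pair is negative. -/
def negProb (k : ℕ) (s : I) (e : NodePair (2 * k)) : I :=
  blockExtend (community k) !![s, σ s; σ s, s] e.1.1 e.1.2

lemma signedBlock_eq (k : ℕ) (p q s : I) :
    signedBlock k p q s = (Measure.pi fun e => bitLaw (edgeProb k p q e) (negProb k s e)).map
      signedAdjacency := rfl

lemma edgeProb_eq (k : ℕ) (p q : I) (e : NodePair (2 * k)) :
    (edgeProb k p q e : ℝ) = (p + q) / 2 + nodeSign k e.1.1 * nodeSign k e.1.2 * ((p - q) / 2) := by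
  simp only [edgeProb, blockExtend, Matrix.of_apply, e.2.ne, if_false, community, nodeSign]
  split_ifs <;> simp <;> ring

lemma negProb_eq (k : ℕ) (s : I) (e : NodePair (2 * k)) :
    1 - 2 * (negProb k s e : ℝ) = nodeSign k e.1.1 * nodeSign k e.1.2 * (1 - 2 * s) := by
  simp only [negProb, blockExtend, Matrix.of_apply, e.2.ne, if_false, community, nodeSign]
  split_ifs <;> simp <;> ring

lemma edgeProb_le (k : ℕ) {p q : I} (hqp : (q : ℝ) ≤ p) (e : NodePair (2 * k)) :
    (edgeProb k p q e : ℝ) ≤ p := by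
  rw [edgeProb_eq]; unfold nodeSign; split_ifs <;> linarith

lemma le_edgeProb (k : ℕ) {p q : I} (hqp : (q : ℝ) ≤ p) (e : NodePair (2 * k)) :
    (q : ℝ) ≤ edgeProb k p q e := by
  rw [edgeProb_eq]; unfold nodeSign; split_ifs <;> linarith

/-- Half the deviation of the matrix with entries `g (ω e)` from its mean. -/
def devMatrix (k : ℕ) (p q s : I) (g : Bool × Bool → ℝ) (ω : NodePair (2 * k) → Bool × Bool) :
    Matrix (Fin (2 * k)) (Fin (2 * k)) ℝ :=
  symMatrix fun e => halfDev (edgeProb k p q e) (negProb k s e) g (ω e)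

lemma apply_pairOf {n : ℕ} {c : Fin n → Fin n → ℝ} (hc : ∀ i j, c i j = c j i) {i j : Fin n}
    (h : i ≠ j) : c (pairOf i j h).1.1 (pairOf i j h).1.2 = c i j := by
  unfold pairOf
  split_ifs
  · rfl
  · exact hc _ _

/-- With `χ` the product of the two community signs, the mean off-diagonal entry is `θχ((p+q)/2 +
χ(p-q)/2)`, and `χ² = 1` gives the two spikes. On the diagonal the spikes sum to `θp`, which must be
removed. -/
lemma signedAdjacency_decomp {k : ℕ} (hk : 0 < k) (p q s : I) {δ ρ : ℝ}
    (hδ : δ = (p + q) * k) (hρ : ρ * δ = (p - q) * k) (ω : NodePair (2 * k) → Bool × Bool)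
    (i j : Fin (2 * k)) :
    signedAdjacency ω i j = 2 * devMatrix k p q s signedEntry ω i j + (1 - 2 * (s : ℝ)) *
      (δ * (meanEigenvector k i * meanEigenvector k j) +
        ρ * δ * (onesVector k i * onesVector k j)) -
      if i = j then (1 - 2 * (s : ℝ)) * p else 0 := by
  have hk' : (k : ℝ) ≠ 0 := by exact_mod_cast hk.ne'
  rw [meanEigenvector_mul, onesVector_mul, hρ, hδ, signedAdjacency_eq, devMatrix]
  by_cases h : i = j
  · subst h
    rw [symMatrix_self, symMatrix_self, nodeSign_mul_self, if_pos rfl]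
    field_simp
    ring
  · rw [symMatrix_of_ne _ h, symMatrix_of_ne _ h, if_neg h, halfDev, integral_signedEntry,
      negProb_eq, edgeProb_eq,
      apply_pairOf (c := fun i j => nodeSign k i * nodeSign k j) (fun _ _ => mul_comm _ _) h]
    have h1 : (nodeSign k i * nodeSign k j) ^ 2 = 1 := by
      rw [mul_pow, sq, sq, nodeSign_mul_self, nodeSign_mul_self, one_mul]
    field_simp
    linear_combination ((p - q) * (1 - 2 * s) : ℝ) * h1

lemma degree_decomp {k : ℕ} (hk : 0 < k) (p q s : I) {δ : ℝ}
    (hδ : δ = (p + q) * k) (ω : NodePair (2 * k) → Bool × Bool) (i : Fin (2 * k)) :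
    degree (signedAdjacency ω) i =
      2 * ∑ j, devMatrix k p q s (fun b => |signedEntry b|) ω i j + δ - p := by
  have hk' : (k : ℝ) ≠ 0 := by exact_mod_cast hk.ne'
  have h : ∀ j, |signedAdjacency ω i j| =
      2 * devMatrix k p q s (fun b => |signedEntry b|) ω i j +
        ((p + q) / 2 + nodeSign k i * nodeSign k j * ((p - q) / 2)) -
        if i = j then (p : ℝ) else 0 := by
    intro j
    rw [signedAdjacency_eq, devMatrix]
    by_cases h : i = j
    · subst h
      rw [symMatrix_self, symMatrix_self, nodeSign_mul_self, if_pos rfl, abs_zero]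
      ring
    · rw [symMatrix_of_ne _ h, symMatrix_of_ne _ h, if_neg h, halfDev,
        integral_abs_signedEntry, edgeProb_eq,
        apply_pairOf (c := fun i j => nodeSign k i * nodeSign k j) (fun _ _ => mul_comm _ _) h]
      ring
  simp only [degree, h, Finset.sum_sub_distrib, Finset.sum_add_distrib, ← Finset.mul_sum,
    ← Finset.sum_mul, sum_nodeSign, hδ]
  simp
  ring

/-- The rate constant of the perturbation, in terms of the norm bound. -/
def rateConst (B : ℝ) : ℝ := 20 * √B + 4 * √(40 * B + 10) + 2 * (40 * B + 10) + 10

lemma IsNearSpike.mono {E : Type*} [NormedAddCommGroup E] [InnerProductSpace ℝ E]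
    {T : E →ₗ[ℝ] E} {u o : E} {θ ρ ε ε' : ℝ} (h : IsNearSpike T u o θ ρ ε) (hε : ε ≤ ε') :
    IsNearSpike T u o θ ρ ε' := fun x y => (h x y).trans (by gcongr)

/-- On the event of regular degrees and small deviations, the normalized Laplacian is close to
its population version. -/
lemma isNearSpike_of_regular {k : ℕ} (hk : 3 ≤ k) {p q s : I} {γ₁ γ₂ B : ℝ} (hγ₂ : 1 < γ₂)
    (hγ : γ₂ < γ₁) (hs : (s : ℝ) < 1 / 2) (hB : 0 < B)
    (hp : (p : ℝ) = γ₁ * Real.log k / k) (hq : (q : ℝ) = γ₂ * Real.log k / k)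
    {ω : NodePair (2 * k) → Bool × Bool}
    (hd : ∀ i, Real.log k / 10 < degree (signedAdjacency ω) i)
    (h1 : ‖devMatrix k p q s signedEntry ω‖ ≤ √(B * Real.log k))
    (h2 : ‖devMatrix k p q s (fun b => |signedEntry b|) ω‖ ≤ √(B * Real.log k)) :
    IsNearSpike (Matrix.toEuclideanLin (normalizedLaplacian (signedAdjacency ω)))
      (meanEigenvector k) (onesVector k) (1 - 2 * s) ((γ₁ - γ₂) / (γ₁ + γ₂))
      (rateConst B / √(Real.log k)) := by
  have hl1 := one_le_log_natCast hk
  set l := Real.log k with hl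
  have hl0 : 0 < l := by linarith
  have hk0 : 0 < k := by omega
  have hk' : (0 : ℝ) < k := by exact_mod_cast hk0
  have hn : 0 < 2 * k := by omega
  have hg : 0 < γ₁ + γ₂ := by linarith
  have hs0 := s.2.1
  have hδ : (γ₁ + γ₂) * l = (p + q) * k := by rw [hp, hq]; field_simp
  have hρ : (γ₁ - γ₂) / (γ₁ + γ₂) * ((γ₁ + γ₂) * l) = (p - q) * k := by
    rw [hp, hq]; field_simp
  have hd0 : ∀ i, 0 < degree (signedAdjacency ω) i := fun i =>
    lt_trans (by positivity) (hd i)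
  have hM : ∀ i, (degree (signedAdjacency ω) i)⁻¹ ≤ 10 / l := fun i => by
    rw [← inv_div]
    exact inv_anti₀ (by positivity) (hd i).le
  have hdeg := sum_sq_degree_sub_le (degree_decomp hk0 p q s hδ ω) h2
  have hη := sum_sqrt_ratio_le hn (by positivity) hd0 hM hdeg
  set r := √l with hr
  have hr0 : 0 < r := Real.sqrt_pos.2 hl0
  have hr2 : r ^ 2 = l := Real.sq_sqrt hl0.le
  have hr1 : 1 ≤ r := Real.one_le_sqrt.2 hl1
  have hp1 := p.2.2
  have hp0 := p.2.1
  set H := √(40 * B + 10) with hH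
  have hH2 : H ^ 2 = 40 * B + 10 := Real.sq_sqrt (by positivity)
  -- From `p ≤ 1 ≤ l` and `γ₁ + γ₂ ≥ 2` the left side is at most `(8B + 2)·10/(2l)`; this fixes `40B
  -- + 10`.
  have hη' : (8 * √(B * l) ^ 2 + 2 * (p : ℝ) ^ 2) * (10 / l) / ((γ₁ + γ₂) * l) ≤ (H / r) ^ 2 := by
    rw [Real.sq_sqrt (by positivity), div_pow, hH2, hr2]
    have e1 : 8 * (B * l) + 2 * (p : ℝ) ^ 2 ≤ (8 * B + 2) * l := by nlinarith
    calc _ ≤ (8 * B + 2) * l * (10 / l) / (2 * l) := by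
          gcongr
          linarith
      _ = _ := by field_simp; ring
  refine (isNearSpike_normalizedLaplacian (signedAdjacency_decomp hk0 p q s hδ hρ ω) hd0
    (by positivity) hM h1 (norm_eq_one_of_sq hn (meanEigenvector_sq k))
    (norm_eq_one_of_sq hn (onesVector_sq k)) (meanEigenvector_sq k) (onesVector_sq k)
    (by positivity : 0 ≤ H / r) (by positivity) (hη.trans hη') (by linarith) (by linarith)
    (div_nonneg (by linarith) hg.le) ((div_le_one hg).2 (by linarith)) hp0).mono ?_
  rw [rateConst, ← hH, Real.sqrt_mul hB.le, ← hr, ← hH2, ← hr2, le_div_iff₀ hr0]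
  have e1 : (2 * (√B * r) * (10 / r ^ 2) + 2 * (2 * (H / r) + (H / r) ^ 2) +
      p * (10 / r ^ 2)) * r = 20 * √B + 4 * H + 2 * H ^ 2 * r⁻¹ + p * 10 * r⁻¹ := by
    field_simp; ring
  rw [e1]
  have e2 : r⁻¹ ≤ 1 := inv_le_one_of_one_le₀ hr1
  have e3 : (p : ℝ) * 10 * r⁻¹ ≤ 1 * 10 * 1 := by gcongr
  have e4 : 2 * H ^ 2 * r⁻¹ ≤ 2 * H ^ 2 * 1 := by gcongr
  linarith

/-- The norm bound for the deviation matrices of the bisection model. -/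
lemma exists_norm_devMatrix_bound {γ₁ γ₂ : ℝ} (hγ₂ : 1 < γ₂) (hγ : γ₂ < γ₁) :
    ∃ B : ℝ, 0 < B ∧ ∃ K : ℕ, ∀ k : ℕ, K ≤ k → ∀ p q s : I,
      (p : ℝ) = γ₁ * Real.log k / k → (q : ℝ) = γ₂ * Real.log k / k →
      ∀ g : Bool × Bool → ℝ, (∀ b, |g b| ≤ 1) → (∀ c, g (false, c) = 0) →
      (Measure.pi fun e => bitLaw (edgeProb k p q e) (negProb k s e)).real
        {ω | √(B * Real.log k) < ‖devMatrix k p q s g ω‖} ≤ (k : ℝ)⁻¹ := by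
  obtain ⟨B, hB, K, h⟩ := exists_norm_symMatrix_bound (2 * γ₁) (by linarith)
  refine ⟨B, hB, max 3 K, fun k hk p q s hp hq g hg hg0 => ?_⟩
  have hk3 : 3 ≤ k := (le_max_left _ _).trans hk
  have hk' : (0 : ℝ) < k := by exact_mod_cast (by omega : 0 < k)
  have hl1 := one_le_log_natCast hk3
  have hqp : (q : ℝ) ≤ p := by rw [hp, hq]; gcongr
  refine h k ((le_max_right _ _).trans hk)
    (fun e => bitLaw (edgeProb k p q e) (negProb k s e))
    (fun e => halfDev (edgeProb k p q e) (negProb k s e) g) p ?_ p.2.2 (le_of_eq ?_)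
    (fun e => abs_halfDev_le _ _ hg) (fun e => integral_halfDev _ _ _)
    fun e => (integral_halfDev_sq_le _ _ hg hg0).trans (edgeProb_le k hqp e)
  · rw [hp, inv_eq_one_div]
    gcongr
    nlinarith
  · rw [hp]; field_simp

/-- With high probability all degrees are at least of order `log k`. -/
lemma measure_degree_le_exp {k : ℕ} (hk : 3 ≤ k) {p q s : I} {γ₁ γ₂ : ℝ} (hγ₂ : 1 < γ₂)
    (hγ : γ₂ < γ₁) (hp : (p : ℝ) = γ₁ * Real.log k / k) (hq : (q : ℝ) = γ₂ * Real.log k / k) :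
    (Measure.pi fun e => bitLaw (edgeProb k p q e) (negProb k s e)).real
      {ω | ∃ i, degree (signedAdjacency ω) i ≤ Real.log k / 10} ≤
      6 * Real.exp (-(Real.log k / 2)) := by
  have hl1 := one_le_log_natCast hk
  have hk' : (0 : ℝ) < k := by exact_mod_cast (by omega : 0 < k)
  have hqp : (q : ℝ) ≤ p := by rw [hp, hq]; gcongr
  refine (measure_degree_le _ _ (le_edgeProb k hqp) _).trans ?_
  set l := Real.log k with hl
  have hq1 := q.2.2
  -- Here `γ₂ > 1` enters: the Chernoff exponent is at most `0.2 l - 0.85(2l - 1) ≤ 1 - 3l/2`, and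
  -- the union over `2k = 2 exp l` nodes still leaves `exp(-l/2)`.
  have h1 : 2 * l - 1 ≤ (((2 * k : ℕ) : ℝ) - 1) * q := by
    have : (((2 * k : ℕ) : ℝ) - 1) * q = 2 * (γ₂ * l) - q := by
      push_cast; rw [hq]; field_simp
    rw [this]
    nlinarith
  have h2 : (k : ℝ) = Real.exp l := (Real.exp_log hk').symm
  calc _ ≤ ((2 * k : ℕ) : ℝ) * Real.exp (1 + (-l + -(l / 2))) := by
        gcongr
        linarith
    _ = 2 * Real.exp 1 * Real.exp (-(l / 2)) := by
        rw [Real.exp_add, Real.exp_add]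
        push_cast
        rw [h2]
        have : Real.exp l * Real.exp (-l) = 1 := by rw [← Real.exp_add]; simp
        linear_combination (2 * Real.exp 1 * Real.exp (-(l / 2))) * this
    _ ≤ _ := by
        gcongr
        linarith [Real.exp_one_lt_d9]

/-- This direction holds for arbitrary sets, so the spectral event never has to be proved
measurable. -/
lemma measureReal_preimage_le_signedBlock (k : ℕ) (p q s : I)
    (S : Set (Matrix (Fin (2 * k)) (Fin (2 * k)) ℝ)) :
    (Measure.pi fun e => bitLaw (edgeProb k p q e) (negProb k s e)).real
      (signedAdjacency ⁻¹' S) ≤ (signedBlock k p q s).real S := by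
  have hm : Measurable
      (signedAdjacency : (NodePair (2 * k) → Bool × Bool) → Matrix _ _ ℝ) :=
    measurable_of_finite _
  rw [signedBlock_eq]
  have := Measure.isProbabilityMeasure_map (μ := Measure.pi fun e =>
    bitLaw (edgeProb k p q e) (negProb k s e)) hm.aemeasurable
  exact ENNReal.toReal_mono (measure_ne_top _ _) (Measure.le_map_apply hm.aemeasurable S)

end SignedSBM

end

/-! ### Union bound over the bad events and choice of constants -/

theorem corollary4p12 (γ₁ γ₂ : ℝ) (hγ₂ : 1 < γ₂) (hγ : γ₂ < γ₁)
    (s : unitInterval) (hs₀ : 0 < (s : ℝ)) (hs : (s : ℝ) < 1 / 2) :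
    ∃ C₁ : ℝ, 0 < C₁ ∧ ∃ C₂ : ℝ, 0 < C₂ ∧ ∃ K : ℕ, ∀ k : ℕ, K ≤ k →
      ∀ p q : unitInterval,
        (p : ℝ) = γ₁ * Real.log k / k → (q : ℝ) = γ₂ * Real.log k / k →
        1 - (k : ℝ) ^ (-C₁) ≤ (SignedSBM.signedBlock k p q s).real
          {A : Matrix (Fin (2 * k)) (Fin (2 * k)) ℝ |
            let X := SignedSBM.normalizedLaplacian A
            let l := SignedSBM.leastEigenvalue X
            SignedSBM.IsSimpleEigenvalue X l ∧
            (∀ u v : EuclideanSpace ℝ (Fin (2 * k)),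
              SignedSBM.IsUnitEigenvector X l u → SignedSBM.IsUnitEigenvector X l v →
                v = u ∨ v = -u) ∧
            (∀ u : EuclideanSpace ℝ (Fin (2 * k)), SignedSBM.IsUnitEigenvector X l u →
              ∃ τ : ℝ, (τ = 1 ∨ τ = -1) ∧
                ‖τ • u - SignedSBM.meanEigenvector k‖ ≤ C₂ * Real.log k ^ (-1 / 2 : ℝ))} := by
  open SignedSBM Matrix.Norms.L2Operator in
  obtain ⟨B, hB, K, hK⟩ := exists_norm_devMatrix_bound hγ₂ hγ
  have hg : 0 < γ₁ + γ₂ := by linarith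
  have hρ0 : 0 ≤ (γ₁ - γ₂) / (γ₁ + γ₂) := div_nonneg (by linarith) hg.le
  have hρ1 : (γ₁ - γ₂) / (γ₁ + γ₂) < 1 := (div_lt_one hg).2 (by linarith)
  set ρ := (γ₁ - γ₂) / (γ₁ + γ₂) with hρ
  have hθ : 0 < 1 - 2 * (s : ℝ) := by linarith
  set θ := 1 - 2 * (s : ℝ) with hθ'
  have hgap : 0 < θ * (1 - ρ) := mul_pos hθ (by linarith)
  have hC : 0 < rateConst B := by unfold rateConst; positivity
  -- `log k ≥ 12` gives `8 exp(-(log k)/2) ≤ k^(-1/4)`, where `8 = 6 + 1 + 1` collects the three bad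
  -- events. The last threshold makes the perturbation at most a quarter of the gap.
  refine ⟨1 / 4, by norm_num, 4 / (θ * (1 - ρ)) * rateConst B, by positivity,
    max K (max ⌈Real.exp 12⌉₊ ⌈Real.exp ((4 * rateConst B / (θ * (1 - ρ))) ^ 2)⌉₊), ?_⟩
  intro k hk p q hp hq
  have hkK : K ≤ k := (le_max_left _ _).trans hk
  have hk12 : Real.exp 12 ≤ k := (Nat.le_ceil _).trans
    (by exact_mod_cast (le_max_left _ _).trans ((le_max_right _ _).trans hk))
  have hkC : Real.exp ((4 * rateConst B / (θ * (1 - ρ))) ^ 2) ≤ k := (Nat.le_ceil _).trans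
    (by exact_mod_cast (le_max_right _ _).trans ((le_max_right _ _).trans hk))
  have hk' : (0 : ℝ) < k := (Real.exp_pos _).trans_le hk12
  have hl12 : 12 ≤ Real.log k := (Real.le_log_iff_exp_le hk').2 hk12
  have hlC : (4 * rateConst B / (θ * (1 - ρ))) ^ 2 ≤ Real.log k :=
    (Real.le_log_iff_exp_le hk').2 hkC
  have hk3 : 3 ≤ k := by
    have h1 := Real.add_one_le_exp (12 : ℝ)
    have : (3 : ℝ) ≤ k := by linarith
    exact_mod_cast this
  set l := Real.log k with hl
  have hl0 : 0 < l := by linarith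
  have hr0 : 0 < √l := Real.sqrt_pos.2 hl0
  have : NeZero (2 * k) := ⟨by omega⟩
  refine le_trans ?_ (measureReal_preimage_le_signedBlock k p q s _)
  set μ := Measure.pi fun e => bitLaw (edgeProb k p q e) (negProb k s e) with hμ
  set G : Set (NodePair (2 * k) → Bool × Bool) :=
    ({ω | ∃ i, degree (signedAdjacency ω) i ≤ l / 10} ∪
      {ω | √(B * l) < ‖devMatrix k p q s signedEntry ω‖}) ∪
      {ω | √(B * l) < ‖devMatrix k p q s (fun b => |signedEntry b|) ω‖} with hG
  have hGm : μ.real G ≤ (k : ℝ) ^ (-(1 / 4 : ℝ)) := by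
    have h1 : μ.real G ≤ 6 * Real.exp (-(l / 2)) + (k : ℝ)⁻¹ + (k : ℝ)⁻¹ := by
      refine (measureReal_union_le _ _).trans (add_le_add
        ((measureReal_union_le _ _).trans (add_le_add ?_ ?_)) ?_)
      · exact measure_degree_le_exp hk3 hγ₂ hγ hp hq
      · exact hK k hkK p q s hp hq _ abs_signedEntry_le fun c => by simp [signedEntry]
      · exact hK k hkK p q s hp hq _ (fun b => by rw [abs_abs]; exact abs_signedEntry_le b)
          fun c => by simp [signedEntry]
    have h2 : (k : ℝ)⁻¹ ≤ Real.exp (-(l / 2)) := by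
      rw [← Real.exp_log hk', ← Real.exp_neg]
      exact Real.exp_le_exp.2 (by linarith)
    have h3 : (k : ℝ) ^ (-(1 / 4 : ℝ)) = Real.exp (-(l / 2)) * Real.exp (l / 4) := by
      rw [Real.rpow_def_of_pos hk', ← Real.exp_add, ← hl]
      congr 1; ring
    have h4 : 8 ≤ Real.exp (l / 4) := by
      calc (8 : ℝ) = 2 ^ 3 := by norm_num
        _ ≤ Real.exp 1 ^ 3 := by gcongr; linarith [Real.exp_one_gt_d9]
        _ = Real.exp 3 := by rw [← Real.exp_nat_mul]; norm_num
        _ ≤ _ := Real.exp_le_exp.2 (by linarith)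
    rw [h3]
    nlinarith [Real.exp_pos (-(l / 2))]
  calc 1 - (k : ℝ) ^ (-(1 / 4 : ℝ)) ≤ 1 - μ.real G := by linarith
    _ = μ.real Gᶜ := (probReal_compl_eq_one_sub (Set.toFinite G).measurableSet).symm
    _ ≤ _ := by
      refine measureReal_mono (fun ω hω => ?_) (measure_ne_top _ _)
      simp only [hG, Set.compl_union, Set.mem_inter_iff, Set.mem_compl_iff, Set.mem_ofPred_eq,
        not_exists, not_le, not_lt] at hω
      have hspike := isNearSpike_of_regular hk3 hγ₂ hγ hs hB hp hq hω.1.1 hω.1.2 hω.2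
      have hn : 0 < 2 * k := by omega
      have hε : rateConst B / √l ≤ θ * (1 - ρ) / 4 := by
        have h1 := Real.le_sqrt_of_sq_le hlC
        rw [div_le_iff₀ hgap] at h1
        rw [div_le_iff₀ hr0]
        linarith
      have hherm : (normalizedLaplacian (signedAdjacency ω)).IsHermitian :=
        normalizedLaplacian_isHermitian fun i j => by
          rw [signedAdjacency_eq]; exact symMatrix_comm _ i j
      have hfin := spectral_of_isNearSpike hherm hspike
        (norm_eq_one_of_sq hn (meanEigenvector_sq k)) (norm_eq_one_of_sq hn (onesVector_sq k))
        (inner_meanEigenvector_onesVector k) hθ hρ0 hρ1 hε (by positivity)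
      have hpow : rateConst B / √l = rateConst B * l ^ (-1 / 2 : ℝ) := by
        rw [neg_div, Real.rpow_neg hl0.le, ← Real.sqrt_eq_rpow, div_eq_mul_inv]
      rw [hpow, ← mul_assoc] at hfin
      exact hfin
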